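/- Consider the initial value problem for the Benjamin–Bona–Mahony (BBM) equation on the line, for real-valued $u=u(x,t)$, $$\partial_t u+(1-\partial_x^2)^{-1}\big(\partial_x u+u\,\partial_x u\big)=0,\qquad u(x,0)=u_0(x),\tag{BBM}$$ where $u\,\partial_xu=\partial_x(u^2/2)$, where $(1-\partial_x^2)^{-1}$ is the Fourier multiplier with symbol $(1+4\pi^2\xi^2)^{-1}$, and where the equation is understood in the sense of tempered distributions in $x$: for every Schwartz function $\psi$ the map $t\mapsto\langle u(t),\psi\rangle$ is differentiable on $[-T,T]$ (one-sidedly at the endpoints) with derivative $-\langle(1-\partial_x^2)^{-1}\partial_x(u+u^2/2)(t),\psi\rangle$. Let $H^s(\mathbb R)$, $s\in\mathbb R$, be the $L^2$-based Sobolev spaces. For an integer $k\ge 0$ and $\theta\in[0,1]$ let $C^{k,\theta}(\mathbb R)$ be the space of functions $f:\mathbb R\to\mathbb R$ of class $C^k$ for which $$\|f\|_{C^{k,\theta}}=\sum_{j=0}^k\|f^{(j)}\|_\infty+\sup_{h\ne0}\Big\|\frac{f^{(k)}(\cdot+h)-f^{(k)}(\cdot)}{|h|^\theta}\Big\|_\infty<\infty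 .$$ Let $T>0$. (i) Let $s\ge 0$, $u_0\in H^s(\mathbb R)$, and let $u\in C([-T,T]:H^s(\mathbb R))$ be a solution of (BBM) on $[-T,T]$. If $s\in[0,1/2]$, then $u-u_0\in C^\infty([-T,T]:H^{\sigma}(\mathbb R))$ for every $\sigma<2s+\tfrac12$. If $s>1/2$, then $u-u_0\in C^\infty([-T,T]:H^{s+1}(\mathbb R))$. (ii) Let $k\ge 0$ be an integer, $\theta\in[0,1]$, $u_0\in C^{k,\theta}(\mathbb R)$, and let $u\in C([-T,T]:C^{k,\theta}(\mathbb R))$ be a solution of (BBM) on $[-T,T]$. Then $u-u_0\in C^\infty([-T,T]:C^{k+1,\theta}(\mathbb R))$. -/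

import Mathlib

open scoped SchwartzMap ContDiff

noncomputable section

namespace BBM

/-! ### Bessel potentials, regular distributions, Sobolev spaces on the line -/

/-- The symbol of `J ^ s = (1 - ∂ₓ²) ^ (s / 2)`. -/
def besselSymbol (s : ℝ) (ξ : ℝ) : ℝ := (1 + 4 * Real.pi ^ 2 * ξ ^ 2) ^ (s / 2)

/-- The symbol is smooth of moderate growth, so that it is a multiplier of tempered distributions. -/
theorem besselSymbol_hasTemperateGrowth (s : ℝ) :
    (fun ξ : ℝ ↦ (besselSymbol s ξ : ℂ)).HasTemperateGrowth := by
  have h1 : (fun x : ℝ ↦ (1 + ‖x‖ ^ 2) ^ (s / 2)).HasTemperateGrowth :=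
    Function.hasTemperateGrowth_one_add_norm_sq_rpow ℝ (s / 2)
  have h2 : (fun ξ : ℝ ↦ (2 * Real.pi) * ξ).HasTemperateGrowth := by fun_prop
  have h3 : (besselSymbol s).HasTemperateGrowth := by
    have := h1.comp h2
    convert this using 1
    ext ξ
    simp only [besselSymbol, Function.comp, Real.norm_eq_abs, sq_abs]
    ring_nf
  fun_prop

/-- `J ^ s = (1 - ∂ₓ²) ^ (s / 2)` on tempered distributions,
i.e. `J ^ s f = 𝓕⁻ ((1 + 4 π² ξ²) ^ (s / 2) 𝓕 f)`. -/
def J (s : ℝ) : 𝓢'(ℝ, ℂ) →L[ℂ] 𝓢'(ℝ, ℂ) :=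
  TemperedDistribution.fourierMultiplierCLM ℂ (fun ξ : ℝ ↦ (besselSymbol s ξ : ℂ))

/-- The tempered distribution `F` is the (real valued) function `f`. -/
def IsFunction (F : 𝓢'(ℝ, ℂ)) (f : ℝ → ℝ) : Prop :=
  ∀ ψ : 𝓢(ℝ, ℂ), MeasureTheory.Integrable (fun x ↦ ψ x * (f x : ℂ)) ∧
    F ψ = ∫ x, ψ x * (f x : ℂ)

/-- The tempered distributions in `H ^ s(ℝ)`. -/
def sobolevSubmodule (s : ℝ) : Submodule ℂ 𝓢'(ℝ, ℂ) where
  carrier := {f | TemperedDistribution.MemSobolev s 2 f}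
  add_mem' hf hg := hf.add hg
  zero_mem' := TemperedDistribution.memSobolev_fun_zero ℝ ℂ s 2
  smul_mem' c _ hf := hf.smul c

/-- The Sobolev space `H ^ s(ℝ)`. It is a type of its own, so that it carries the Sobolev norm and
not the topology of tempered distributions. -/
def Sobolev (s : ℝ) : Type := ↥(sobolevSubmodule s)

namespace Sobolev

variable {s : ℝ}

instance : AddCommGroup (Sobolev s) := inferInstanceAs (AddCommGroup ↥(sobolevSubmodule s))

instance : Module ℂ (Sobolev s) := inferInstanceAs (Module ℂ ↥(sobolevSubmodule s))

/-- The underlying tempered distribution. -/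
def toDistribution : Sobolev s →ₗ[ℂ] 𝓢'(ℝ, ℂ) := (sobolevSubmodule s).subtype

theorem toDistribution_injective : Function.Injective (toDistribution (s := s)) :=
  (sobolevSubmodule s).injective_subtype

theorem toTemperedDistribution_injective :
    Function.Injective
      (MeasureTheory.Lp.toTemperedDistributionCLM ℂ (MeasureTheory.volume : MeasureTheory.Measure ℝ)
        2) :=
  LinearMap.ker_eq_bot.1 MeasureTheory.Lp.ker_toTemperedDistributionCLM_eq_bot

/-- The `L²` function given by the Bessel potential of order `s` of an element of `H ^ s(ℝ)`. -/
def toL2 : Sobolev s →ₗ[ℂ] MeasureTheory.Lp ℂ 2 (MeasureTheory.volume : MeasureTheory.Measure ℝ) where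
  toFun f := Classical.choose f.2
  map_add' f g := by
    apply toTemperedDistribution_injective
    rw [map_add]
    simp only [MeasureTheory.Lp.toTemperedDistributionCLM_apply]
    rw [← Classical.choose_spec f.2, ← Classical.choose_spec g.2,
      ← Classical.choose_spec (f + g).2, ← map_add]
    rfl
  map_smul' c f := by
    apply toTemperedDistribution_injective
    rw [map_smul]
    simp only [MeasureTheory.Lp.toTemperedDistributionCLM_apply]
    rw [← Classical.choose_spec f.2, ← Classical.choose_spec (c • f).2, RingHom.id_apply,
      ← map_smul]
    rfl

theorem toL2_spec (f : Sobolev s) :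
    TemperedDistribution.besselPotential ℝ ℂ s (toDistribution f) =
      MeasureTheory.Lp.toTemperedDistribution (toL2 f) :=
  Classical.choose_spec f.2

theorem toL2_injective : Function.Injective (toL2 (s := s)) := by
  intro f g h
  apply toDistribution_injective
  have h1 := toL2_spec f
  rw [h, ← toL2_spec g] at h1
  have h2 := congrArg (TemperedDistribution.besselPotential ℝ ℂ (-s)) h1
  simpa using h2

/-- The Sobolev norm `‖f‖ = ‖(1 + ξ²) ^ (s / 2) 𝓕 f‖_{L²}`. Replacing the weight by
`(1 + 4 π² ξ²) ^ (s / 2)` gives the same space and an equivalent norm. -/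
instance : NormedAddCommGroup (Sobolev s) :=
  NormedAddCommGroup.induced (Sobolev s)
    (MeasureTheory.Lp ℂ 2 (MeasureTheory.volume : MeasureTheory.Measure ℝ)) toL2 toL2_injective

instance : NormedSpace ℂ (Sobolev s) :=
  NormedSpace.induced ℂ (Sobolev s)
    (MeasureTheory.Lp ℂ 2 (MeasureTheory.volume : MeasureTheory.Measure ℝ)) toL2

end Sobolev

/-- The function `f` belongs to `H ^ s(ℝ)`. -/
def MemSobolev (s : ℝ) (f : ℝ → ℝ) : Prop := ∃ F : Sobolev s, IsFunction F.toDistribution f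

/-- `v ∈ C ^ n([-T, T] : H ^ s(ℝ))`. -/
def ContDiffInSobolev (n : WithTop ℕ∞) (T s : ℝ) (v : ℝ → ℝ → ℝ) : Prop :=
  ∃ V : ℝ → Sobolev s, ContDiffOn ℝ n V (Set.Icc (-T) T) ∧
    ∀ t ∈ Set.Icc (-T) T, IsFunction (V t).toDistribution (v t)

/-! ### Hölder spaces on the line -/

/-- The functions `f ∈ C ^ k` whose derivatives up to order `k` are bounded and whose derivative of
order `k` is Hölder continuous of exponent `θ`. -/
def MemHolder (k : ℕ) (θ : ℝ) (f : ℝ → ℝ) : Prop :=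
  ContDiff ℝ k f ∧ (∀ j ≤ k, ∃ C : ℝ, ∀ x, |iteratedDeriv j f x| ≤ C) ∧
    ∃ C : ℝ, ∀ x h : ℝ, |iteratedDeriv k f (x + h) - iteratedDeriv k f x| ≤ C * |h| ^ θ

theorem iteratedDeriv_add_apply {k j : ℕ} (hj : j ≤ k) {f g : ℝ → ℝ} (hf : ContDiff ℝ k f)
    (hg : ContDiff ℝ k g) (x : ℝ) :
    iteratedDeriv j (f + g) x = iteratedDeriv j f x + iteratedDeriv j g x :=
  iteratedDeriv_add ((hf.of_le (by exact_mod_cast hj)).contDiffAt)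
    ((hg.of_le (by exact_mod_cast hj)).contDiffAt)

theorem iteratedDeriv_smul_apply {k j : ℕ} (hj : j ≤ k) (c : ℝ) {f : ℝ → ℝ} (hf : ContDiff ℝ k f)
    (x : ℝ) : iteratedDeriv j (c • f) x = c * iteratedDeriv j f x :=
  iteratedDeriv_const_smul ((hf.of_le (by exact_mod_cast hj)).contDiffAt) c

/-- `C ^ {k, θ}(ℝ)` as a space of functions. -/
def holderSubmodule (k : ℕ) (θ : ℝ) : Submodule ℝ (ℝ → ℝ) where
  carrier := {f | MemHolder k θ f}
  add_mem' := by
    rintro f g ⟨hf, hfb, C, hC⟩ ⟨hg, hgb, D, hD⟩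
    refine ⟨hf.add hg, fun j hj ↦ ?_, C + D, fun x h ↦ ?_⟩
    · obtain ⟨A, hA⟩ := hfb j hj
      obtain ⟨B, hB⟩ := hgb j hj
      refine ⟨A + B, fun x ↦ ?_⟩
      rw [iteratedDeriv_add_apply hj hf hg]
      exact (abs_add_le _ _).trans (add_le_add (hA x) (hB x))
    · rw [iteratedDeriv_add_apply le_rfl hf hg, iteratedDeriv_add_apply le_rfl hf hg,
        add_sub_add_comm, add_mul]
      exact (abs_add_le _ _).trans (add_le_add (hC x h) (hD x h))
  zero_mem' := by
    refine ⟨contDiff_const, fun j _ ↦ ⟨0, fun x ↦ ?_⟩, 0, fun x h ↦ ?_⟩ <;>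
      simp
  smul_mem' := by
    rintro c f ⟨hf, hfb, C, hC⟩
    refine ⟨contDiff_const.smul hf, fun j hj ↦ ?_, |c| * C, fun x h ↦ ?_⟩
    · obtain ⟨A, hA⟩ := hfb j hj
      refine ⟨|c| * A, fun x ↦ ?_⟩
      rw [iteratedDeriv_smul_apply hj c hf, abs_mul]
      exact mul_le_mul_of_nonneg_left (hA x) (abs_nonneg c)
    · rw [iteratedDeriv_smul_apply le_rfl c hf, iteratedDeriv_smul_apply le_rfl c hf, ← mul_sub,
        abs_mul, mul_assoc]
      exact mul_le_mul_of_nonneg_left (hC x h) (abs_nonneg c)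

/-- The Hölder space `C ^ {k, θ}(ℝ)`; a type of its own, so that it carries the Hölder norm. -/
def Holder (k : ℕ) (θ : ℝ) : Type := ↥(holderSubmodule k θ)

namespace Holder

variable {k : ℕ} {θ : ℝ}

instance : AddCommGroup (Holder k θ) := inferInstanceAs (AddCommGroup ↥(holderSubmodule k θ))

instance : Module ℝ (Holder k θ) := inferInstanceAs (Module ℝ ↥(holderSubmodule k θ))

/-- The underlying function. -/
def toFun : Holder k θ →ₗ[ℝ] (ℝ → ℝ) := (holderSubmodule k θ).subtype

theorem toFun_injective : Function.Injective (toFun (k := k) (θ := θ)) :=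
  (holderSubmodule k θ).injective_subtype

theorem memHolder (f : Holder k θ) : MemHolder k θ f.toFun := f.2

/-- The difference quotient `(f⁽ᵏ⁾(x + h) - f⁽ᵏ⁾(x)) / |h| ^ θ` at `p = (x, h)`, where `h ≠ 0`. -/
def quotient (k : ℕ) (θ : ℝ) (f : ℝ → ℝ) (p : ℝ × {h : ℝ // h ≠ 0}) : ℝ :=
  (iteratedDeriv k f (p.1 + p.2) - iteratedDeriv k f p.1) / |(p.2 : ℝ)| ^ θ

/-- `‖f‖ = ∑_{j ≤ k} sup |f⁽ʲ⁾| + sup_{h ≠ 0, x} |f⁽ᵏ⁾(x + h) - f⁽ᵏ⁾(x)| / |h| ^ θ`. -/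
instance : Norm (Holder k θ) where
  norm f := ∑ j ∈ Finset.range (k + 1), (⨆ x : ℝ, |iteratedDeriv j f.toFun x|) +
    ⨆ p, |quotient k θ f.toFun p|

theorem norm_def (f : Holder k θ) :
    ‖f‖ = ∑ j ∈ Finset.range (k + 1), (⨆ x : ℝ, |iteratedDeriv j f.toFun x|) +
      ⨆ p, |quotient k θ f.toFun p| := rfl

theorem bddAbove_deriv (f : Holder k θ) {j : ℕ} (hj : j ≤ k) :
    BddAbove (Set.range fun x : ℝ ↦ |iteratedDeriv j f.toFun x|) := by
  obtain ⟨C, hC⟩ := f.memHolder.2.1 j hj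
  exact ⟨C, by rintro _ ⟨x, rfl⟩; exact hC x⟩

theorem bddAbove_quotient (f : Holder k θ) :
    BddAbove (Set.range fun p ↦ |quotient k θ f.toFun p|) := by
  obtain ⟨C, hC⟩ := f.memHolder.2.2
  refine ⟨C, ?_⟩
  rintro _ ⟨⟨x, h, hh⟩, rfl⟩
  have hpos : 0 < |h| ^ θ := Real.rpow_pos_of_pos (abs_pos.2 hh) θ
  simp only [quotient, abs_div, abs_of_pos hpos]
  rw [div_le_iff₀ hpos]
  exact hC x h

theorem iSup_abs_add_le {ι : Type*} [Nonempty ι] {a b c : ι → ℝ} (h : ∀ i, c i = a i + b i)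
    (ha : BddAbove (Set.range fun i ↦ |a i|)) (hb : BddAbove (Set.range fun i ↦ |b i|)) :
    (⨆ i, |c i|) ≤ (⨆ i, |a i|) + ⨆ i, |b i| :=
  ciSup_le fun i ↦ by
    rw [h]
    exact (abs_add_le _ _).trans (add_le_add (le_ciSup ha i) (le_ciSup hb i))

theorem iSup_abs_smul {ι : Type*} {a c : ι → ℝ} (r : ℝ) (h : ∀ i, c i = r * a i) :
    (⨆ i, |c i|) = |r| * ⨆ i, |a i| := by
  simp_rw [h, abs_mul]
  exact (Real.mul_iSup_of_nonneg (abs_nonneg r) _).symm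

theorem core : NormedSpace.Core ℝ (Holder k θ) where
  norm_nonneg f := by
    rw [norm_def]
    exact add_nonneg (Finset.sum_nonneg fun _ _ ↦ Real.iSup_nonneg fun _ ↦ abs_nonneg _)
      (Real.iSup_nonneg fun _ ↦ abs_nonneg _)
  norm_smul c f := by
    rw [norm_def, norm_def, mul_add, Finset.mul_sum, Real.norm_eq_abs]
    congr 1
    · refine Finset.sum_congr rfl fun j hj ↦ iSup_abs_smul c fun x ↦ ?_
      rw [map_smul, iteratedDeriv_smul_apply (Nat.lt_succ_iff.1 (Finset.mem_range.1 hj)) c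
        f.memHolder.1]
    · refine iSup_abs_smul c fun p ↦ ?_
      rw [map_smul, quotient, quotient, iteratedDeriv_smul_apply le_rfl c f.memHolder.1,
        iteratedDeriv_smul_apply le_rfl c f.memHolder.1]
      ring
  norm_triangle f g := by
    have : Nonempty (ℝ × {h : ℝ // h ≠ 0}) := ⟨(0, ⟨1, one_ne_zero⟩)⟩
    rw [norm_def, norm_def, norm_def, add_add_add_comm, ← Finset.sum_add_distrib]
    refine add_le_add (Finset.sum_le_sum fun j hj ↦ ?_) ?_
    · have hj' := Nat.lt_succ_iff.1 (Finset.mem_range.1 hj)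
      refine iSup_abs_add_le (fun x ↦ ?_) (f.bddAbove_deriv hj') (g.bddAbove_deriv hj')
      rw [map_add, iteratedDeriv_add_apply hj' f.memHolder.1 g.memHolder.1]
    · refine iSup_abs_add_le (fun p ↦ ?_) f.bddAbove_quotient g.bddAbove_quotient
      rw [map_add, quotient, quotient, quotient,
        iteratedDeriv_add_apply le_rfl f.memHolder.1 g.memHolder.1,
        iteratedDeriv_add_apply le_rfl f.memHolder.1 g.memHolder.1]
      ring
  norm_eq_zero_iff f := by
    constructor
    · intro h
      rw [norm_def] at h
      have h1 : ∀ j ∈ Finset.range (k + 1), 0 ≤ ⨆ x : ℝ, |iteratedDeriv j f.toFun x| :=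
        fun _ _ ↦ Real.iSup_nonneg fun _ ↦ abs_nonneg _
      have h2 : 0 ≤ ⨆ p, |quotient k θ f.toFun p| := Real.iSup_nonneg fun _ ↦ abs_nonneg _
      have h3 : (⨆ x : ℝ, |iteratedDeriv 0 f.toFun x|) = 0 :=
        (Finset.sum_eq_zero_iff_of_nonneg h1).1
          (le_antisymm (by linarith) (Finset.sum_nonneg h1)) 0 (by simp)
      apply toFun_injective
      ext x
      have h4 := le_ciSup (f.bddAbove_deriv (Nat.zero_le k)) x
      rw [h3] at h4
      simpa using h4
    · rintro rfl
      rw [norm_def]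
      simp [quotient]

instance : NormedAddCommGroup (Holder k θ) := NormedAddCommGroup.ofCore core

instance : NormedSpace ℝ (Holder k θ) := NormedSpace.ofCore core

end Holder

/-- `v ∈ C ^ n([-T, T] : C ^ {k, θ}(ℝ))`. -/
def ContDiffInHolder (n : WithTop ℕ∞) (T : ℝ) (k : ℕ) (θ : ℝ) (v : ℝ → ℝ → ℝ) : Prop :=
  ∃ V : ℝ → Holder k θ, ContDiffOn ℝ n V (Set.Icc (-T) T) ∧
    ∀ t ∈ Set.Icc (-T) T, (V t).toFun = v t

/-! ### Solutions of the initial value problem -/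

/-- `u` (where `u t x` is the value at time `t` and position `x`) solves
`∂ₜ u + (1 - ∂ₓ²)⁻¹ (∂ₓ u + u ∂ₓ u) = 0` on `[-T, T] × ℝ` in the sense of tempered distributions
in `x`, with `u ∂ₓ u = ∂ₓ (u² / 2)`, and `u(0) = u₀` almost everywhere. -/
structure IsSolution (T : ℝ) (u₀ : ℝ → ℝ) (u : ℝ → ℝ → ℝ) : Prop where
  initial : u 0 =ᵐ[MeasureTheory.volume] u₀
  equation : ∃ U N : ℝ → 𝓢'(ℝ, ℂ), ∀ t ∈ Set.Icc (-T) T,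
    IsFunction (U t) (u t) ∧ IsFunction (N t) (fun x ↦ u t x + u t x ^ 2 / 2) ∧
      ∀ ψ : 𝓢(ℝ, ℂ), HasDerivWithinAt (fun τ ↦ U τ ψ)
        (-(J (-2) (TemperedDistribution.derivCLM ℂ (N t)) ψ)) (Set.Icc (-T) T) t

end BBM

end

/-!
Write the equation as `∂ₜ u = F(u)` with `F(u) = -(1 - ∂ₓ²)⁻¹ ∂ₓ (u + u² / 2)`. In each of the
spaces `E` of the theorem, `F` is a continuous quadratic polynomial from `E` to a smoother space
`E'`, hence of class `C^∞`. So the equation is an ordinary differential equation in `E`, and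
`u(t) - u₀ = ∫₀ᵗ F(u(τ)) dτ` holds in `E'`: both sides are equal because they have the same
derivative when tested against Schwartz functions. If `u - u₀` is of class `C^n` in time with values in `E'`,
then so is `F(u)`, and `u - u₀` is of class `C^(n + 1)`. This argument is
`exists_contDiffOn_lift_of_weak_ode`; the rest is the proof that `F` maps `E` to `E'`.

For Sobolev spaces, `(1 - ∂ₓ²)⁻¹ ∂ₓ` gains one derivative (`Sobolev.smoothing`), and products of
elements of `H ^ s` lie in `H ^ r` whenever `0 ≤ s`, `r ≤ s` and `r < 2 * s - 1 / 2`
(`Sobolev.exists_mul`). On the Fourier side the product is a convolution, and the pointwise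
inequality `weight_le` distributes the weight of order `r` so that a square integrable weight of
order `r - 2 * s < -1 / 2` is left on one of the three factors; Young's inequality and the
Cauchy-Schwarz inequality finish the estimate for Schwartz functions, and density extends it. The
choice `r = max (σ - 1) (s - 1)` gives the case `s ≤ 1 / 2`, and `r = s` the case `1 / 2 < s`.

For Hölder spaces, products stay in `C ^ {k, θ}` (`MemHolder.mul`), and `(1 - ∂ₓ²)⁻¹ ∂ₓ` is an
explicit integral operator built from the bounded solutions of `a' + a = f` and `b - b' = f`;
these equations show the gain of one derivative (`MemHolder.smoothingFun`,
`IsFunction.smoothingFun`).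

All the spaces are complete. Boundedness of the linear operators comes from the closed graph
theorem, except for Sobolev multiplication, where it is the estimate above.
-/

noncomputable section

namespace BBM

open Set Filter Topology MeasureTheory

/-! ### Smoothness in time of solutions of an ordinary differential equation -/

/-- Let `F : E → E'` be smooth, where `E'` is mapped into `E` by `j`. If `U` is continuous in `E`
and solves `U' = j (F U)` when tested against the separating family of functionals `ℓ`, then
`U - U 0` is the image under `j` of a smooth `E'`-valued function. -/
theorem exists_contDiffOn_lift_of_weak_ode {E E' G ι : Type*}
    [NormedAddCommGroup E] [NormedSpace ℝ E]
    [NormedAddCommGroup E'] [NormedSpace ℝ E'] [CompleteSpace E']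
    [NormedAddCommGroup G] [NormedSpace ℝ G] (j : E' →L[ℝ] E) {F : E → E'} (hF : ContDiff ℝ ∞ F)
    {T : ℝ} (hT : 0 < T) {U : ℝ → E} (hU : ContinuousOn U (Icc (-T) T)) (ℓ : ι → E →L[ℝ] G)
    (hsep : ∀ x, (∀ i, ℓ i x = 0) → x = 0)
    (hode : ∀ t ∈ Icc (-T) T, ∀ i,
      HasDerivWithinAt (fun τ ↦ ℓ i (U τ)) (ℓ i (j (F (U t)))) (Icc (-T) T) t) :
    ∃ V : ℝ → E', ContDiffOn ℝ ∞ V (Icc (-T) T) ∧ ∀ t ∈ Icc (-T) T, j (V t) = U t - U 0 := by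
  have hTT : -T ≤ T := by linarith
  have h0 : (0 : ℝ) ∈ Icc (-T) T := ⟨by linarith, hT.le⟩
  have huniq : UniqueDiffOn ℝ (Icc (-T) T) := uniqueDiffOn_Icc (by linarith)
  set g : ℝ → E' := IccExtend hTT ((Icc (-T) T).domRestrict fun t ↦ F (U t)) with hg
  have hgc : Continuous g :=
    (continuousOn_iff_continuous_domRestrict.1 (hF.continuous.comp_continuousOn hU)).Icc_extend'
  have hgF : ∀ t ∈ Icc (-T) T, g t = F (U t) := fun t ht ↦ by
    rw [hg, IccExtend_of_mem _ _ ht, domRestrict_apply]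
  set V : ℝ → E' := fun t ↦ ∫ τ in (0 : ℝ)..t, g τ with hV
  have hVd : ∀ t, HasDerivAt V (g t) t := fun t ↦ hgc.integral_hasStrictDerivAt 0 t |>.hasDerivAt
  have hV0 : V 0 = 0 := by simp [hV]
  have key : ∀ t ∈ Icc (-T) T, j (V t) = U t - U 0 := by
    intro t ht
    refine sub_eq_zero.1 (hsep _ fun i ↦ ?_)
    have hd : ∀ τ ∈ Icc (-T) T, HasDerivWithinAt (fun τ ↦ ℓ i (j (V τ)) - ℓ i (U τ)) 0
        (Icc (-T) T) τ := by
      intro τ hτ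
      have h1 : HasDerivAt (fun τ ↦ ℓ i (j (V τ))) (ℓ i (j (g τ))) τ :=
        ((ℓ i).comp j).hasFDerivAt.comp_hasDerivAt τ (hVd τ)
      have h2 := h1.hasDerivWithinAt.sub (hode τ hτ i)
      rwa [hgF τ hτ, sub_self] at h2
    have h3 := (convex_Icc (-T) T).norm_image_sub_le_of_norm_hasDerivWithin_le (C := 0) hd
      (fun _ _ ↦ by simp) h0 ht
    rw [zero_mul, norm_le_zero_iff, sub_eq_zero, hV0] at h3
    simp only [map_sub, map_zero] at h3 ⊢
    rw [← sub_add, h3]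
    abel
  refine ⟨V, contDiffOn_infty.2 fun n ↦ ?_, key⟩
  induction n with
  | zero => exact contDiffOn_zero.2 fun t _ ↦ (hVd t).continuousAt.continuousWithinAt
  | succ n ih =>
    -- `V' = F (U 0 + j V)` has as many derivatives as `V`.
    refine (contDiffOn_succ_iff_derivWithin (n := n) huniq).2
      ⟨fun t _ ↦ (hVd t).differentiableAt.differentiableWithinAt, by simp, ?_⟩
    have h1 : ContDiffOn ℝ n (fun t ↦ F (U 0 + j (V t))) (Icc (-T) T) :=
      (hF.of_le (by exact_mod_cast le_top)).comp_contDiffOn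
        (contDiffOn_const.add (j.contDiff.comp_contDiffOn ih))
    refine h1.congr fun t ht ↦ ?_
    rw [(hVd t).hasDerivWithinAt.derivWithin (huniq t ht), hgF t ht, key t ht, add_sub_cancel]

/-! ### Sobolev spaces as Banach spaces of distributions -/

namespace Sobolev

variable {s r : ℝ}

theorem toL2_surjective : Function.Surjective (toL2 (s := s)) := by
  intro a
  have h : TemperedDistribution.besselPotential ℝ ℂ s
      (TemperedDistribution.besselPotential ℝ ℂ (-s) (a : 𝓢'(ℝ, ℂ))) = a := by simp
  refine ⟨⟨TemperedDistribution.besselPotential ℝ ℂ (-s) (a : 𝓢'(ℝ, ℂ)), a, h⟩, ?_⟩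
  apply toTemperedDistribution_injective
  simp only [Lp.toTemperedDistributionCLM_apply]
  exact (toL2_spec _).symm.trans h

variable (s) in
/-- The Bessel potential of order `s` as an isometry of `H ^ s` onto `L²`. -/
def equivL2 : Sobolev s ≃ₗᵢ[ℂ] Lp ℂ 2 (volume : Measure ℝ) where
  toLinearEquiv := LinearEquiv.ofBijective toL2 ⟨toL2_injective, toL2_surjective⟩
  norm_map' _ := rfl

theorem equivL2_apply (f : Sobolev s) : equivL2 s f = toL2 f := rfl

instance : CompleteSpace (Sobolev s) :=
  (equivL2 s).toIsometryEquiv.isometry.isUniformInducing.completeSpace_congr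
    (equivL2 s).surjective |>.2 inferInstance

theorem toDistribution_eq (f : Sobolev s) : toDistribution f =
    TemperedDistribution.besselPotential ℝ ℂ (-s) (toL2 f : 𝓢'(ℝ, ℂ)) := by
  rw [← toL2_spec]
  simp

theorem continuous_toDistribution : Continuous (toDistribution (s := s)) := by
  have h : (toDistribution (s := s) : Sobolev s → 𝓢'(ℝ, ℂ)) =
      (TemperedDistribution.besselPotential ℝ ℂ (-s) ∘L
        Lp.toTemperedDistributionCLM ℂ (volume : Measure ℝ) 2) ∘ equivL2 s := by
    ext1 f
    simp [toDistribution_eq, equivL2_apply]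
  rw [h]
  exact (ContinuousLinearMap.continuous _).comp (equivL2 s).continuous

theorem toDistribution_mem (f : Sobolev s) : toDistribution f ∈ sobolevSubmodule s := f.2

/-- A continuous operator on tempered distributions that maps `H ^ s` to `H ^ r`, as a bounded
operator; boundedness is the closed graph theorem. -/
def map (A : 𝓢'(ℝ, ℂ) →L[ℂ] 𝓢'(ℝ, ℂ))
    (hA : ∀ f ∈ sobolevSubmodule s, A f ∈ sobolevSubmodule r) :
    Sobolev s →L[ℂ] Sobolev r :=
  let A' : Sobolev s →ₗ[ℂ] Sobolev r :=
    { toFun f := ⟨A (toDistribution f), hA _ f.toDistribution_mem⟩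
      map_add' f g := toDistribution_injective (by
        change A (toDistribution (f + g)) = A (toDistribution f) + A (toDistribution g)
        simp)
      map_smul' c f := toDistribution_injective (by
        change A (toDistribution (c • f)) = c • A (toDistribution f)
        simp) }
  { A' with
    cont := A'.continuous_of_seq_closed_graph fun u x y hu hy ↦ by
      apply toDistribution_injective
      have h1 : Tendsto (fun n ↦ toDistribution (A' (u n))) atTop (𝓝 (toDistribution y)) :=
        (continuous_toDistribution.tendsto y).comp hy
      have h2 : Tendsto (fun n ↦ A (toDistribution (u n))) atTop (𝓝 (A (toDistribution x))) :=
        (A.continuous.tendsto _).comp ((continuous_toDistribution.tendsto x).comp hu)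
      exact tendsto_nhds_unique h1 h2 }

@[simp]
theorem toDistribution_map (A : 𝓢'(ℝ, ℂ) →L[ℂ] 𝓢'(ℝ, ℂ))
    (hA : ∀ f ∈ sobolevSubmodule s, A f ∈ sobolevSubmodule r)
    (f : Sobolev s) : toDistribution (map A hA f) = A (toDistribution f) := rfl

/-- The inclusion of `H ^ s` into `H ^ r` for `r ≤ s`. -/
def inclusion (h : r ≤ s) : Sobolev s →L[ℂ] Sobolev r :=
  map (ContinuousLinearMap.id ℂ _) fun _ hf ↦ TemperedDistribution.MemSobolev.mono h hf

@[simp]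
theorem toDistribution_inclusion (h : r ≤ s) (f : Sobolev s) :
    toDistribution (inclusion h f) = toDistribution f :=
  toDistribution_map _ _ f

theorem J_neg_two_derivCLM_mem {f : 𝓢'(ℝ, ℂ)} (hf : f ∈ sobolevSubmodule r) :
    J (-2) (TemperedDistribution.derivCLM ℂ f) ∈ sobolevSubmodule (r + 1) := by
  have h1 := TemperedDistribution.MemSobolev.lineDerivOp (F := ℂ) (m := (1 : ℝ)) hf
  have h2 := (TemperedDistribution.memSobolev_besselPotential_iff (s := r + 1) (r := -2)).2
    (by convert h1 using 1; ring)
  -- `J (-2)` differs from Mathlib's Bessel potential by a bounded multiplier.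
  have hm : (fun ξ : ℝ ↦ (((1 + ‖ξ‖ ^ 2) ^ ((2 : ℝ) / 2) : ℝ) : ℂ) *
      (besselSymbol (-2) ξ : ℂ)).HasTemperateGrowth := by
    have := besselSymbol_hasTemperateGrowth (-2)
    fun_prop
  have h3 := h2.fourierMultiplierCLM_of_bounded hm ⟨1, fun ξ ↦ ?_⟩
  · have h4 : J (-2) (TemperedDistribution.derivCLM ℂ f) =
        TemperedDistribution.fourierMultiplierCLM ℂ
          (fun ξ : ℝ ↦ (((1 + ‖ξ‖ ^ 2) ^ ((2 : ℝ) / 2) : ℝ) : ℂ) * (besselSymbol (-2) ξ : ℂ))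
          (TemperedDistribution.besselPotential ℝ ℂ (-2) (TemperedDistribution.derivCLM ℂ f)) := by
      rw [TemperedDistribution.besselPotential.eq_1, J,
        TemperedDistribution.fourierMultiplierCLM_fourierMultiplierCLM_apply (by fun_prop) hm]
      congr 2
      ext ξ
      simp only [Pi.mul_apply]
      rw [← mul_assoc, ← Complex.ofReal_mul, ← Real.rpow_add (by positivity)]
      norm_num
    rw [h4]
    exact h3
  · rw [← Complex.ofReal_mul, Complex.norm_real, Real.norm_eq_abs, abs_of_nonneg (by
      unfold besselSymbol; positivity)]
    have hpi : (1 : ℝ) ≤ 4 * Real.pi ^ 2 := by nlinarith [Real.pi_gt_three]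
    simp only [besselSymbol, Real.norm_eq_abs, sq_abs]
    norm_num
    rw [Real.rpow_neg_one, ← div_eq_mul_inv, div_le_one (by positivity)]
    nlinarith [sq_nonneg ξ]

/-- The operator `(1 - ∂ₓ²)⁻¹ ∂ₓ` from `H ^ r` to `H ^ (r + 1)`. -/
def smoothing (r : ℝ) : Sobolev r →L[ℂ] Sobolev (r + 1) :=
  map (J (-2) ∘L TemperedDistribution.derivCLM ℂ) fun _ hf ↦ J_neg_two_derivCLM_mem hf

@[simp]
theorem toDistribution_smoothing (f : Sobolev r) : toDistribution (smoothing r f) =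
    J (-2) (TemperedDistribution.derivCLM ℂ (toDistribution f)) := rfl

variable (s) in
/-- A Schwartz function as an element of `H ^ s`. -/
def ofSchwartz : 𝓢(ℝ, ℂ) →ₗ[ℂ] Sobolev s where
  toFun φ := ⟨(φ : 𝓢'(ℝ, ℂ)), φ.memSobolev⟩
  map_add' φ ψ := toDistribution_injective
    ((SchwartzMap.toTemperedDistributionCLM ℝ ℂ volume).map_add φ ψ)
  map_smul' c φ := toDistribution_injective
    ((SchwartzMap.toTemperedDistributionCLM ℝ ℂ volume).map_smul c φ)

@[simp]
theorem toDistribution_ofSchwartz (φ : 𝓢(ℝ, ℂ)) :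
    toDistribution (ofSchwartz s φ) = (φ : 𝓢'(ℝ, ℂ)) := rfl

theorem toL2_ofSchwartz (φ : 𝓢(ℝ, ℂ)) : toL2 (ofSchwartz s φ) =
    (SchwartzMap.fourierMultiplierCLM ℂ
      (fun ξ : ℝ ↦ (((1 + ‖ξ‖ ^ 2) ^ (s / 2) : ℝ) : ℂ)) φ).toLp 2 := by
  apply toTemperedDistribution_injective
  simp only [Lp.toTemperedDistributionCLM_apply]
  rw [← toL2_spec, toDistribution_ofSchwartz, Lp.toTemperedDistribution_toLp_eq,
    TemperedDistribution.besselPotential,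
    TemperedDistribution.fourierMultiplierCLM_toTemperedDistributionCLM_eq (by fun_prop)]

theorem denseRange_ofSchwartz : DenseRange (ofSchwartz s) := by
  have h1 : DenseRange fun φ : 𝓢(ℝ, ℂ) ↦ (equivL2 s).symm (φ.toLp 2) :=
    (equivL2 s).symm.surjective.denseRange.comp
      (SchwartzMap.denseRange_toLpCLM (p := 2) (F := ℂ) (E := ℝ) (μ := volume)
        ENNReal.ofNat_ne_top) (equivL2 s).symm.continuous
  refine h1.mono ?_
  rintro _ ⟨φ, rfl⟩
  refine ⟨SchwartzMap.fourierMultiplierCLM ℂ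
      (fun ξ : ℝ ↦ (((1 + ‖ξ‖ ^ 2) ^ (-s / 2) : ℝ) : ℂ)) φ, ?_⟩
  apply (equivL2 s).injective
  rw [LinearIsometryEquiv.apply_symm_apply, equivL2_apply, toL2_ofSchwartz,
    SchwartzMap.fourierMultiplierCLM_fourierMultiplierCLM_apply (by fun_prop) (by fun_prop)]
  congr 1
  convert! congrFun (congrArg DFunLike.coe
    (SchwartzMap.fourierMultiplierCLM_const (E := ℝ) (F := ℂ) (1 : ℂ))) φ using 3
  · ext ξ
    simp only [Pi.mul_apply]
    rw [← Complex.ofReal_mul, ← Real.rpow_add (by positivity)]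
    ring_nf
    simp
  · simp

/-- The norm of a Schwartz function in `H ^ s` in terms of its Fourier transform. -/
theorem enorm_ofSchwartz_sq (φ : 𝓢(ℝ, ℂ)) : ‖ofSchwartz s φ‖ₑ ^ 2 =
    ∫⁻ ξ, (ENNReal.ofReal ((1 + ξ ^ 2) ^ (s / 2)) *
      ‖FourierTransform.fourier φ ξ‖ₑ) ^ 2 := by
  have h1 : ‖ofSchwartz s φ‖ₑ = ‖toL2 (ofSchwartz s φ)‖ₑ := rfl
  rw [h1, toL2_ofSchwartz, enorm_eq_nnnorm, ← (Lp.fourierTransformₗᵢ ℝ ℂ).nnnorm_map,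
    ← enorm_eq_nnnorm]
  change ‖FourierTransform.fourier (SchwartzMap.toLp (E := ℝ) (F := ℂ) _ 2 volume)‖ₑ ^ 2 = _
  have h2 := SchwartzMap.coeFn_toLp (SchwartzMap.smulLeftCLM ℂ
    (fun ξ : ℝ ↦ (((1 + ‖ξ‖ ^ 2) ^ (s / 2) : ℝ) : ℂ)) (FourierTransform.fourier φ)) 2 volume
  rw [SchwartzMap.toLp_fourier_eq, SchwartzMap.fourierMultiplierCLM_apply,
    FourierTransform.fourier_fourierInv_eq, Lp.enorm_def, eLpNorm_congr_ae h2,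
    eLpNorm_eq_lintegral_rpow_enorm_toReal (by norm_num) (by norm_num), ← ENNReal.rpow_natCast,
    ← ENNReal.rpow_mul]
  norm_num only [ENNReal.toReal_ofNat]
  rw [ENNReal.rpow_one]
  refine lintegral_congr fun ξ ↦ ?_
  rw [SchwartzMap.smulLeftCLM_apply_apply (by fun_prop), smul_eq_mul, enorm_mul,
    ENNReal.rpow_ofNat]
  congr 2
  rw [← ofReal_norm, Complex.norm_real, Real.norm_eq_abs, abs_of_nonneg (by positivity),
    Real.norm_eq_abs, sq_abs]

end Sobolev

/-! ### The product estimate in Sobolev spaces -/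

section ProductEstimate

open scoped ENNReal

theorem sq_lintegral_mul_le {f g : ℝ → ℝ≥0∞} (hf : Measurable f) (hg : Measurable g) :
    (∫⁻ x, f x * g x) ^ 2 ≤ (∫⁻ x, f x ^ 2) * ∫⁻ x, g x ^ 2 := by
  have h := ENNReal.lintegral_mul_le_Lp_mul_Lq volume Real.HolderConjugate.two_two
    hf.aemeasurable hg.aemeasurable
  have h2 := pow_le_pow_left' h 2
  simp only [Pi.mul_apply] at h2
  refine h2.trans_eq ?_
  rw [mul_pow, ← ENNReal.rpow_natCast, ← ENNReal.rpow_natCast, ← ENNReal.rpow_mul,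
    ← ENNReal.rpow_mul]
  norm_num

section Convolution

variable {w a b : ℝ → ℝ≥0∞}

theorem lintegral_sq_mul_convolution_le (hw : Measurable w) (ha : Measurable a)
    (hb : Measurable b) :
    ∫⁻ x, (w x * ∫⁻ y, a y * b (x - y)) ^ 2 ≤
      (∫⁻ x, w x ^ 2) * (∫⁻ x, a x ^ 2) * ∫⁻ x, b x ^ 2 := by
  have h : ∀ x, (w x * ∫⁻ y, a y * b (x - y)) ^ 2 ≤
      w x ^ 2 * ((∫⁻ x, a x ^ 2) * ∫⁻ x, b x ^ 2) := fun x ↦ by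
    rw [mul_pow]
    gcongr
    refine (sq_lintegral_mul_le ha (hb.comp (measurable_const.sub measurable_id))).trans_eq ?_
    congr 1
    exact lintegral_sub_left_eq_self (fun y ↦ b y ^ 2) x
  refine (lintegral_mono h).trans_eq ?_
  rw [lintegral_mul_const _ (hw.pow_const 2), mul_assoc]

/-- Young's inequality `L¹ * L² ⊂ L²`, with the Cauchy-Schwarz inequality for the `L¹` norm
of `w a`. -/
theorem lintegral_sq_convolution_mul_left_le (hw : Measurable w) (ha : Measurable a)
    (hb : Measurable b) :
    ∫⁻ x, (∫⁻ y, w y * a y * b (x - y)) ^ 2 ≤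
      (∫⁻ x, w x ^ 2) * (∫⁻ x, a x ^ 2) * ∫⁻ x, b x ^ 2 := by
  -- Split `A b = A ^ (1 / 2) * (A ^ (1 / 2) b)` before applying the Cauchy-Schwarz inequality.
  set A : ℝ → ℝ≥0∞ := fun y ↦ w y * a y with hA
  have hAm : Measurable A := hw.mul ha
  have hAA : ∀ y, (A y ^ (1 / 2 : ℝ)) ^ 2 = A y := fun y ↦ by
    rw [← ENNReal.rpow_natCast, ← ENNReal.rpow_mul]
    norm_num
  have h : ∀ x, (∫⁻ y, A y * b (x - y)) ^ 2 ≤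
      (∫⁻ y, A y) * ∫⁻ y, A y * b (x - y) ^ 2 := fun x ↦ by
    have h1 := sq_lintegral_mul_le (f := fun y ↦ A y ^ (1 / 2 : ℝ))
      (g := fun y ↦ A y ^ (1 / 2 : ℝ) * b (x - y)) (by fun_prop) (by fun_prop)
    simp only [mul_pow, hAA] at h1
    refine le_trans (le_of_eq ?_) h1
    congr 1
    refine lintegral_congr fun y ↦ ?_
    rw [← mul_assoc, ← sq, hAA]
  calc ∫⁻ x, (∫⁻ y, w y * a y * b (x - y)) ^ 2
      ≤ ∫⁻ x, (∫⁻ y, A y) * ∫⁻ y, A y * b (x - y) ^ 2 := lintegral_mono h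
    _ = (∫⁻ y, A y) * ∫⁻ x, ∫⁻ y, A y * b (x - y) ^ 2 := by
      rw [lintegral_const_mul]
      exact Measurable.lintegral_prod_right
        ((hAm.comp measurable_snd).mul ((hb.comp (measurable_fst.sub measurable_snd)).pow_const 2))
    _ = (∫⁻ y, A y) * ∫⁻ y, ∫⁻ x, A y * b (x - y) ^ 2 := by
      rw [lintegral_lintegral_swap]
      exact ((hAm.comp measurable_snd).mul
        ((hb.comp (measurable_fst.sub measurable_snd)).pow_const 2)).aemeasurable
    _ = (∫⁻ y, A y) * ∫⁻ y, A y * ∫⁻ x, b x ^ 2 := by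
      congr 1
      refine lintegral_congr fun y ↦ ?_
      rw [lintegral_const_mul _ (by fun_prop : Measurable fun x ↦ b (x - y) ^ 2),
        lintegral_sub_right_eq_self (fun x ↦ b x ^ 2) y]
    _ = (∫⁻ y, A y) ^ 2 * ∫⁻ x, b x ^ 2 := by
      rw [lintegral_mul_const _ hAm, sq, mul_assoc]
    _ ≤ _ := by
      gcongr
      exact sq_lintegral_mul_le hw ha

theorem lintegral_sq_convolution_mul_right_le (hw : Measurable w) (ha : Measurable a)
    (hb : Measurable b) :
    ∫⁻ x, (∫⁻ y, a y * (w (x - y) * b (x - y))) ^ 2 ≤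
      (∫⁻ x, w x ^ 2) * (∫⁻ x, a x ^ 2) * ∫⁻ x, b x ^ 2 := by
  have h := lintegral_sq_convolution_mul_left_le hw hb ha
  rw [mul_right_comm] at h
  refine le_trans (le_of_eq (lintegral_congr fun x ↦ ?_)) h
  rw [← lintegral_sub_left_eq_self _ x]
  simp only [sub_sub_cancel]
  simp only [mul_comm]

end Convolution

/-- The exponents of the three-term bound balance: `β = α + α + (β - 2 * α)`. -/
theorem rpow_le_mul_rpow_sum {α β X Y Z : ℝ} (hα : 0 ≤ α) (hβ : β ≤ α) (hX : 1 ≤ X)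
    (hY : 1 ≤ Y) (hZ : 1 ≤ Z) (h : X ≤ 4 * max Y Z) :
    X ^ β ≤ 4 ^ |β| * (Y ^ α * Z ^ α *
      (X ^ (β - 2 * α) + Y ^ (β - 2 * α) + Z ^ (β - 2 * α))) := by
  have hX0 : 0 < X := by linarith
  have hY0 : 0 < Y := by linarith
  have hZ0 : 0 < Z := by linarith
  have h4 : (1 : ℝ) ≤ 4 ^ |β| := Real.one_le_rpow (by norm_num) (abs_nonneg _)
  -- It suffices to bound by one of the three terms.
  have key : X ^ β ≤ 4 ^ |β| * (Y ^ α * Z ^ α * X ^ (β - 2 * α)) ∨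
      X ^ β ≤ 4 ^ |β| * (Y ^ α * Z ^ α * Y ^ (β - 2 * α)) ∨
      X ^ β ≤ 4 ^ |β| * (Y ^ α * Z ^ α * Z ^ (β - 2 * α)) := by
    have eY : Y ^ α * Z ^ α * Y ^ (β - 2 * α) = Z ^ α * Y ^ (β - α) := by
      rw [show β - α = α + (β - 2 * α) by ring, Real.rpow_add hY0]
      ring
    have eZ : Y ^ α * Z ^ α * Z ^ (β - 2 * α) = Y ^ α * Z ^ (β - α) := by
      rw [show β - α = α + (β - 2 * α) by ring, Real.rpow_add hZ0]
      ring
    rw [eY, eZ]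
    rcases le_total β 0 with hβ0 | hβ0
    · -- For `β ≤ 0` the term of the smallest of `X`, `Y`, `Z` dominates.
      by_cases hXm : X ≤ Y ∧ X ≤ Z
      · refine Or.inl (le_trans ?_ (le_mul_of_one_le_left (by positivity) h4))
        calc X ^ β = X ^ α * X ^ α * X ^ (β - 2 * α) := by
              rw [← Real.rpow_add hX0, ← Real.rpow_add hX0]
              ring_nf
          _ ≤ _ := by
            gcongr
            exacts [hXm.1, hXm.2]
      · have hmin : (Y ≤ X ∧ Y ≤ Z) ∨ (Z ≤ X ∧ Z ≤ Y) := by grind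
        rcases hmin with ⟨h1, h2⟩ | ⟨h1, h2⟩
        · refine Or.inr (Or.inl (le_trans ?_ (le_mul_of_one_le_left (by positivity) h4)))
          calc X ^ β ≤ Y ^ β := Real.rpow_le_rpow_of_nonpos hY0 h1 hβ0
            _ = Y ^ α * Y ^ (β - α) := by rw [← Real.rpow_add hY0]; ring_nf
            _ ≤ _ := by gcongr
        · refine Or.inr (Or.inr (le_trans ?_ (le_mul_of_one_le_left (by positivity) h4)))
          calc X ^ β ≤ Z ^ β := Real.rpow_le_rpow_of_nonpos hZ0 h1 hβ0
            _ = Z ^ α * Z ^ (β - α) := by rw [← Real.rpow_add hZ0]; ring_nf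
            _ ≤ _ := by gcongr
    · rw [abs_of_nonneg hβ0]
      rcases le_total Y Z with hYZ | hYZ
      · rw [max_eq_right hYZ] at h
        refine Or.inr (Or.inl ?_)
        calc X ^ β ≤ (4 * Z) ^ β := by gcongr
          _ = 4 ^ β * (Z ^ α * Z ^ (β - α)) := by
            rw [Real.mul_rpow (by norm_num) hZ0.le, ← Real.rpow_add hZ0]
            ring_nf
          _ ≤ _ := by
            gcongr 4 ^ β * (Z ^ α * ?_)
            exact Real.rpow_le_rpow_of_nonpos hY0 hYZ (by linarith)
      · rw [max_eq_left hYZ] at h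
        refine Or.inr (Or.inr ?_)
        calc X ^ β ≤ (4 * Y) ^ β := by gcongr
          _ = 4 ^ β * (Y ^ α * Y ^ (β - α)) := by
            rw [Real.mul_rpow (by norm_num) hY0.le, ← Real.rpow_add hY0]
            ring_nf
          _ ≤ _ := by
            gcongr 4 ^ β * (Y ^ α * ?_)
            exact Real.rpow_le_rpow_of_nonpos hZ0 hYZ (by linarith)
  have p1 : 0 < X ^ (β - 2 * α) := by positivity
  have p2 : 0 < Y ^ (β - 2 * α) := by positivity
  have p3 : 0 < Z ^ (β - 2 * α) := by positivity
  rcases key with h | h | h <;> refine h.trans ?_ <;> gcongr <;> linarith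

/-- The Sobolev weight `(1 + ξ²) ^ (s / 2)` as an extended nonnegative number. -/
def weight (s ξ : ℝ) : ℝ≥0∞ := ENNReal.ofReal ((1 + ξ ^ 2) ^ (s / 2))

theorem measurable_weight (s : ℝ) : Measurable (weight s) := by
  unfold weight
  fun_prop

/-- The convolution inequality for Sobolev weights: in each of the three terms the extra weight of
order `r - 2 * s` falls on one factor, and it is square integrable if `r < 2 * s - 1 / 2`. -/
theorem weight_le {s r : ℝ} (hs : 0 ≤ s) (hr : r ≤ s) (x y : ℝ) :
    weight r x ≤ ENNReal.ofReal (4 ^ |r / 2|) * (weight s y * weight s (x - y) *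
      (weight (r - 2 * s) x + weight (r - 2 * s) y + weight (r - 2 * s) (x - y))) := by
  unfold weight
  rw [← ENNReal.ofReal_mul (by positivity), ← ENNReal.ofReal_add (by positivity) (by positivity),
    ← ENNReal.ofReal_add (by positivity) (by positivity), ← ENNReal.ofReal_mul (by positivity),
    ← ENNReal.ofReal_mul (by positivity)]
  refine ENNReal.ofReal_le_ofReal ?_
  have h := rpow_le_mul_rpow_sum (α := s / 2) (β := r / 2) (X := 1 + x ^ 2) (Y := 1 + y ^ 2)
    (Z := 1 + (x - y) ^ 2) (by positivity) (by linarith) (by nlinarith [sq_nonneg x])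
    (by nlinarith [sq_nonneg y]) (by nlinarith [sq_nonneg (x - y)]) ?_
  · convert h using 6 <;> ring
  · rcases le_total (1 + y ^ 2) (1 + (x - y) ^ 2) with h | h
    · rw [max_eq_right h]
      nlinarith [sq_nonneg (2 * y - x)]
    · rw [max_eq_left h]
      nlinarith [sq_nonneg (2 * y - x)]

theorem lintegral_weight_sq_lt_top {p : ℝ} (hp : p < -(1 / 2)) : ∫⁻ ξ, weight p ξ ^ 2 < ⊤ := by
  have h := (integrable_rpow_neg_one_add_norm_sq (E := ℝ) (μ := volume) (r := -2 * p)
    (by simp; linarith)).lintegral_lt_top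
  refine lt_of_eq_of_lt (lintegral_congr fun ξ ↦ ?_) h
  rw [weight, ← ENNReal.ofReal_pow (by positivity), ← Real.rpow_mul_natCast (by positivity),
    Real.norm_eq_abs, sq_abs]
  congr 2
  push_cast
  ring

namespace Sobolev

variable {s r : ℝ}

/-- The inverse Fourier transform of a product is the convolution of the inverse transforms. -/
theorem fourierInv_mul_apply (φ ψ : 𝓢(ℝ, ℂ)) (ξ : ℝ) :
    FourierTransform.fourierInv (SchwartzMap.pairing (ContinuousLinearMap.mul ℂ ℂ) φ ψ) ξ =
      ∫ η, FourierTransform.fourierInv φ η * FourierTransform.fourierInv ψ (ξ - η) := by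
  have h := SchwartzMap.convolution_apply (ContinuousLinearMap.mul ℂ ℂ)
    (FourierTransform.fourierInv φ) (FourierTransform.fourierInv ψ) ξ
  rw [convolution_def] at h
  simpa [SchwartzMap.convolution] using h

theorem enorm_ofSchwartz_sq_fourierInv (φ : 𝓢(ℝ, ℂ)) : ‖ofSchwartz s φ‖ₑ ^ 2 =
    ∫⁻ ξ, (weight s ξ * ‖FourierTransform.fourierInv φ ξ‖ₑ) ^ 2 := by
  rw [enorm_ofSchwartz_sq, ← lintegral_neg_eq_self]
  refine lintegral_congr fun ξ ↦ ?_
  rw [SchwartzMap.fourier_coe, SchwartzMap.fourierInv_coe, Real.fourierInv_eq_fourier_neg, weight,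
    neg_sq]

/-- The product estimate `H ^ s * H ^ s ⊂ H ^ r` for Schwartz functions. -/
theorem exists_norm_ofSchwartz_mul_le (hs : 0 ≤ s) (hr : r ≤ s) (hrs : r < 2 * s - 1 / 2) :
    ∃ C : ℝ, 0 ≤ C ∧ ∀ φ ψ : 𝓢(ℝ, ℂ),
      ‖ofSchwartz r (SchwartzMap.pairing (ContinuousLinearMap.mul ℂ ℂ) φ ψ)‖ ≤
        C * ‖ofSchwartz s φ‖ * ‖ofSchwartz s ψ‖ := by
  set p := r - 2 * s with hp
  set W : ℝ≥0∞ := ∫⁻ ξ, weight p ξ ^ 2 with hW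
  have hWtop : W ≠ ⊤ := (lintegral_weight_sq_lt_top (by linarith)).ne
  set c : ℝ≥0∞ := ENNReal.ofReal (4 ^ |r / 2|) with hc
  set K : ℝ≥0∞ := c ^ 2 * (9 * W) with hK
  have hKtop : K ≠ ⊤ := by finiteness
  have main : ∀ φ ψ : 𝓢(ℝ, ℂ),
      ‖ofSchwartz r (SchwartzMap.pairing (ContinuousLinearMap.mul ℂ ℂ) φ ψ)‖ₑ ^ 2 ≤
        K * ‖ofSchwartz s φ‖ₑ ^ 2 * ‖ofSchwartz s ψ‖ₑ ^ 2 := by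
    intro φ ψ
    simp only [enorm_ofSchwartz_sq_fourierInv]
    set F := FourierTransform.fourierInv φ
    set G := FourierTransform.fourierInv ψ
    set a : ℝ → ℝ≥0∞ := fun ξ ↦ weight s ξ * ‖F ξ‖ₑ with ha
    set b : ℝ → ℝ≥0∞ := fun ξ ↦ weight s ξ * ‖G ξ‖ₑ with hb
    set w : ℝ → ℝ≥0∞ := weight p with hw
    have hwm : Measurable w := measurable_weight p
    have ham : Measurable a := (measurable_weight s).mul F.continuous.enorm.measurable
    have hbm : Measurable b := (measurable_weight s).mul G.continuous.enorm.measurable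
    have hbm' : ∀ x, Measurable fun y ↦ b (x - y) := fun x ↦
      hbm.comp (measurable_const.sub measurable_id)
    have hwm' : ∀ x, Measurable fun y ↦ w (x - y) := fun x ↦
      hwm.comp (measurable_const.sub measurable_id)
    -- The weight of order `p` falls on the output, the first factor, or the second factor.
    set I₁ : ℝ → ℝ≥0∞ := fun x ↦ w x * ∫⁻ y, a y * b (x - y) with hI₁
    set I₂ : ℝ → ℝ≥0∞ := fun x ↦ ∫⁻ y, w y * a y * b (x - y) with hI₂
    set I₃ : ℝ → ℝ≥0∞ := fun x ↦ ∫⁻ y, a y * (w (x - y) * b (x - y)) with hI₃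
    have hI₁m : Measurable I₁ := hwm.mul (Measurable.lintegral_prod_right
        ((ham.comp measurable_snd).mul (hbm.comp (measurable_fst.sub measurable_snd))))
    have hI₂m : Measurable I₂ := Measurable.lintegral_prod_right
        (((hwm.mul ham).comp measurable_snd).mul (hbm.comp (measurable_fst.sub measurable_snd)))
    have point : ∀ x, weight r x *
        ‖FourierTransform.fourierInv (SchwartzMap.pairing (ContinuousLinearMap.mul ℂ ℂ) φ ψ) x‖ₑ ≤
          c * (I₁ x + I₂ x + I₃ x) := by
      intro x
      calc weight r x * ‖FourierTransform.fourierInv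
              (SchwartzMap.pairing (ContinuousLinearMap.mul ℂ ℂ) φ ψ) x‖ₑ
          ≤ weight r x * ∫⁻ y, ‖F y‖ₑ * ‖G (x - y)‖ₑ := by
            rw [fourierInv_mul_apply]
            gcongr
            refine (enorm_integral_le_lintegral_enorm _).trans_eq ?_
            simp [F, G]
        _ = ∫⁻ y, weight r x * (‖F y‖ₑ * ‖G (x - y)‖ₑ) := by
            rw [lintegral_const_mul]
            exact F.continuous.enorm.measurable.mul
              (G.continuous.comp (by fun_prop : Continuous fun y ↦ x - y)).enorm.measurable
        _ ≤ ∫⁻ y, c * (w x * (a y * b (x - y)) + w y * a y * b (x - y) +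
              a y * (w (x - y) * b (x - y))) := by
            refine lintegral_mono fun y ↦ ?_
            refine (mul_le_mul_left (weight_le hs hr x y) _).trans_eq ?_
            simp only [ha, hb, hw, hp, hc]
            ring
        _ = c * (I₁ x + I₂ x + I₃ x) := by
            rw [lintegral_const_mul, lintegral_add_left, lintegral_add_left, lintegral_const_mul]
            · exact ham.mul (hbm' x)
            · exact measurable_const.mul (ham.mul (hbm' x))
            · exact (measurable_const.mul (ham.mul (hbm' x))).add ((hwm.mul ham).mul (hbm' x))
            · exact ((measurable_const.mul (ham.mul (hbm' x))).add
                ((hwm.mul ham).mul (hbm' x))).add (ham.mul ((hwm' x).mul (hbm' x)))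
    -- The Cauchy-Schwarz inequality for the vectors `(x, y, z)` and `(1, 1, 1)`.
    have hsq : ∀ x y z : ℝ≥0∞, (x + y + z) ^ 2 ≤ 3 * (x ^ 2 + y ^ 2 + z ^ 2) := by
      intro x y z
      have h := ENNReal.inner_le_Lp_mul_Lq Finset.univ ![x, y, z] (fun _ ↦ 1)
        Real.HolderConjugate.two_two
      have h2 := pow_le_pow_left' h 2
      rw [mul_pow, ← ENNReal.rpow_natCast (_ ^ (1 / 2 : ℝ)),
        ← ENNReal.rpow_natCast (_ ^ (1 / 2 : ℝ)), ← ENNReal.rpow_mul, ← ENNReal.rpow_mul] at h2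
      norm_num [Fin.sum_univ_three] at h2
      rw [mul_comm]
      exact h2
    calc ∫⁻ x, (weight r x * ‖FourierTransform.fourierInv
            (SchwartzMap.pairing (ContinuousLinearMap.mul ℂ ℂ) φ ψ) x‖ₑ) ^ 2
        ≤ ∫⁻ x, c ^ 2 * (3 * (I₁ x ^ 2 + I₂ x ^ 2 + I₃ x ^ 2)) := by
          refine lintegral_mono fun x ↦ (pow_le_pow_left' (point x) 2).trans ?_
          rw [mul_pow]
          gcongr
          exact hsq _ _ _
      _ = c ^ 2 * (3 * ((∫⁻ x, I₁ x ^ 2) + (∫⁻ x, I₂ x ^ 2) + ∫⁻ x, I₃ x ^ 2)) := by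
          rw [lintegral_const_mul' _ _ (by finiteness), lintegral_const_mul' _ _ (by finiteness),
            lintegral_add_left, lintegral_add_left]
          · exact hI₁m.pow_const 2
          · exact (hI₁m.pow_const 2).add (hI₂m.pow_const 2)
      _ ≤ c ^ 2 * (3 * ((W * (∫⁻ x, a x ^ 2) * ∫⁻ x, b x ^ 2) +
            (W * (∫⁻ x, a x ^ 2) * ∫⁻ x, b x ^ 2) + W * (∫⁻ x, a x ^ 2) * ∫⁻ x, b x ^ 2)) := by
          gcongr
          · exact lintegral_sq_mul_convolution_le hwm ham hbm
          · exact lintegral_sq_convolution_mul_left_le hwm ham hbm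
          · exact lintegral_sq_convolution_mul_right_le hwm ham hbm
      _ = _ := by
          rw [hK]
          ring
  refine ⟨Real.sqrt K.toReal, by positivity, fun φ ψ ↦ ?_⟩
  refine le_of_sq_le_sq ?_ (by positivity)
  have h := ENNReal.toReal_mono (by finiteness) (main φ ψ)
  simp only [ENNReal.toReal_mul, ENNReal.toReal_pow, toReal_enorm] at h
  rw [mul_pow, mul_pow, Real.sq_sqrt ENNReal.toReal_nonneg]
  exact h

end Sobolev

end ProductEstimate

/-! ### Distributions that are functions -/

namespace IsFunction

variable {F G : 𝓢'(ℝ, ℂ)} {f g : ℝ → ℝ}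

theorem distribution_unique (hF : IsFunction F f) (hG : IsFunction G f) : F = G := by
  ext ψ
  rw [(hF ψ).2, (hG ψ).2]

theorem congr_ae (hF : IsFunction F f) (h : f =ᵐ[volume] g) : IsFunction F g := by
  intro ψ
  have h1 : (fun x ↦ ψ x * (f x : ℂ)) =ᵐ[volume] fun x ↦ ψ x * (g x : ℂ) := by
    filter_upwards [h] with x hx
    rw [hx]
  exact ⟨(hF ψ).1.congr h1, (hF ψ).2.trans (integral_congr_ae h1)⟩

theorem sub (hF : IsFunction F f) (hG : IsFunction G g) :
    IsFunction (F - G) (fun x ↦ f x - g x) := by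
  intro ψ
  have h1 : (fun x ↦ ψ x * ((f x - g x : ℝ) : ℂ)) =
      fun x ↦ ψ x * (f x : ℂ) - ψ x * (g x : ℂ) := by
    ext x
    push_cast
    ring
  rw [h1, integral_sub (hF ψ).1 (hG ψ).1, ← (hF ψ).2, ← (hG ψ).2]
  exact ⟨(hF ψ).1.sub (hG ψ).1, rfl⟩

theorem locallyIntegrable (hF : IsFunction F f) : LocallyIntegrable (fun x ↦ (f x : ℂ)) := by
  rw [locallyIntegrable_iff]
  intro K hK
  obtain ⟨R, hR0, hR⟩ := hK.isBounded.subset_closedBall_lt 0 (0 : ℝ)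
  let b : ContDiffBump (0 : ℝ) := ⟨R, R + 1, hR0, by linarith⟩
  have hb : HasCompactSupport fun x ↦ (b x : ℂ) :=
    b.hasCompactSupport.comp_left (g := Complex.ofReal) Complex.ofReal_zero
  have hbs : ContDiff ℝ ∞ fun x ↦ (b x : ℂ) := Complex.ofRealCLM.contDiff.comp b.contDiff
  have h1 := (hF (hb.toSchwartzMap hbs)).1.integrableOn (s := K)
  refine h1.congr_fun (fun x hx ↦ ?_) hK.measurableSet
  simp [b.one_of_mem_closedBall (hR hx)]

/-- A locally integrable function that represents the same distribution agrees almost everywhere;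
it is enough to test against smooth compactly supported functions. -/
theorem ae_eq (hF : IsFunction F f) {u : ℝ → ℂ} (hu : LocallyIntegrable u)
    (h : ∀ ψ : 𝓢(ℝ, ℂ), F ψ = ∫ x, ψ x * u x) : (fun x ↦ (f x : ℂ)) =ᵐ[volume] u := by
  refine ae_eq_of_integral_contDiff_smul_eq hF.locallyIntegrable hu fun b hbs hb ↦ ?_
  have hb' : HasCompactSupport fun x ↦ (b x : ℂ) :=
    hb.comp_left (g := Complex.ofReal) Complex.ofReal_zero
  have hbs' : ContDiff ℝ ∞ fun x ↦ (b x : ℂ) := Complex.ofRealCLM.contDiff.comp hbs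
  have h1 := (hF (hb'.toSchwartzMap hbs')).2.symm.trans (h _)
  simpa using h1

end IsFunction

namespace Sobolev

variable {s r : ℝ}

/-! ### Multiplication in Sobolev spaces -/

/-- The `L²` function that an element of `H ^ s`, `0 ≤ s`, is. -/
def toLp (hs : 0 ≤ s) : Sobolev s →L[ℂ] Lp ℂ 2 (volume : Measure ℝ) :=
  (equivL2 0).toContinuousLinearEquiv.toContinuousLinearMap ∘L inclusion hs

theorem toDistribution_eq_toLp (hs : 0 ≤ s) (f : Sobolev s) :
    toDistribution f = (toLp hs f : 𝓢'(ℝ, ℂ)) := by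
  have h := toL2_spec (inclusion hs f)
  rw [TemperedDistribution.besselPotential_zero, toDistribution_inclusion] at h
  exact h

theorem toLp_ofSchwartz (hs : 0 ≤ s) (φ : 𝓢(ℝ, ℂ)) :
    toLp hs (ofSchwartz s φ) = φ.toLp 2 := by
  apply toTemperedDistribution_injective
  simp only [Lp.toTemperedDistributionCLM_apply]
  rw [← toDistribution_eq_toLp, toDistribution_ofSchwartz, Lp.toTemperedDistribution_toLp_eq]

theorem toLp_ae_eq (hs : 0 ≤ s) {f : Sobolev s} {u : ℝ → ℝ}
    (h : IsFunction (toDistribution f) u) : toLp hs f =ᵐ[volume] fun x ↦ (u x : ℂ) := by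
  refine (h.ae_eq ((Lp.memLp (toLp hs f)).locallyIntegrable (by norm_num)) fun ψ ↦ ?_).symm
  rw [toDistribution_eq_toLp hs, Lp.toTemperedDistribution_apply]
  rfl

/-- Multiplication from `L² × L²` to `L¹`. -/
def mulLp : Lp ℂ 2 (volume : Measure ℝ) →L[ℂ] Lp ℂ 2 (volume : Measure ℝ) →L[ℂ]
    Lp ℂ 1 (volume : Measure ℝ) :=
  (ContinuousLinearMap.mul ℂ ℂ).holderL volume 2 2 1

theorem mulLp_ae_eq (a b : Lp ℂ 2 (volume : Measure ℝ)) :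
    mulLp a b =ᵐ[volume] fun x ↦ a x * b x :=
  (ContinuousLinearMap.mul ℂ ℂ).coeFn_holder a b

/-- Multiplication maps `H ^ s × H ^ s` to `H ^ r` if `r ≤ s` and `r < 2 * s - 1 / 2`: the
estimate for Schwartz functions extends by density in each factor. -/
theorem exists_mul (hs : 0 ≤ s) (hr : r ≤ s) (hrs : r < 2 * s - 1 / 2) :
    ∃ B : Sobolev s →L[ℂ] Sobolev s →L[ℂ] Sobolev r, ∀ f g,
      toDistribution (B f g) = (mulLp (toLp hs f) (toLp hs g) : 𝓢'(ℝ, ℂ)) := by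
  obtain ⟨C, hC0, hC⟩ := exists_norm_ofSchwartz_mul_le hs hr hrs
  let mul (φ : 𝓢(ℝ, ℂ)) : 𝓢(ℝ, ℂ) →L[ℂ] 𝓢(ℝ, ℂ) :=
    SchwartzMap.pairing (ContinuousLinearMap.mul ℂ ℂ) φ
  let m (φ : 𝓢(ℝ, ℂ)) : 𝓢(ℝ, ℂ) →ₗ[ℂ] Sobolev r := ofSchwartz r ∘ₗ (mul φ).toLinearMap
  have hm : ∀ φ ψ, ‖m φ ψ‖ ≤ C * ‖ofSchwartz s φ‖ * ‖ofSchwartz s ψ‖ := hC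
  -- Extend in the second factor for each fixed Schwartz function, then in the first factor.
  let M (φ : 𝓢(ℝ, ℂ)) : Sobolev s →L[ℂ] Sobolev r := (m φ).extendOfNorm (ofSchwartz s)
  have hM : ∀ φ ψ, M φ (ofSchwartz s ψ) = m φ ψ := fun φ ψ ↦
    LinearMap.extendOfNorm_eq denseRange_ofSchwartz ⟨_, hm φ⟩ ψ
  have hext : ∀ P Q : Sobolev s →L[ℂ] Sobolev r,
      (∀ ψ, P (ofSchwartz s ψ) = Q (ofSchwartz s ψ)) → P = Q := fun P Q h ↦
    ContinuousLinearMap.coeFn_injective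
      (denseRange_ofSchwartz.equalizer P.continuous Q.continuous (funext h))
  let M' : 𝓢(ℝ, ℂ) →ₗ[ℂ] Sobolev s →L[ℂ] Sobolev r :=
    { toFun := M
      map_add' φ φ' := hext _ _ fun ψ ↦ by
        rw [add_apply, hM, hM, hM]
        have h : mul (φ + φ') ψ = mul φ ψ + mul φ' ψ := by
          ext x
          simp [mul]
        exact (congrArg (ofSchwartz r) h).trans (map_add (ofSchwartz r) _ _)
      map_smul' c φ := hext _ _ fun ψ ↦ by
        rw [RingHom.id_apply, smul_apply, hM, hM]
        have h : mul (c • φ) ψ = c • mul φ ψ := by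
          ext x
          simp [mul]
        exact (congrArg (ofSchwartz r) h).trans (map_smul (ofSchwartz r) _ _) }
  have hM' : ∀ φ, ‖M' φ‖ ≤ C * ‖ofSchwartz s φ‖ := fun φ ↦
    LinearMap.opNorm_extendOfNorm_le denseRange_ofSchwartz (by positivity) (hm φ)
  let B := M'.extendOfNorm (ofSchwartz s)
  have hB : ∀ φ ψ, B (ofSchwartz s φ) (ofSchwartz s ψ) = m φ ψ := fun φ ψ ↦ by
    rw [show B (ofSchwartz s φ) = M φ from
      LinearMap.extendOfNorm_eq denseRange_ofSchwartz ⟨_, hM'⟩ φ, hM]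
  refine ⟨B, fun f g ↦ ?_⟩
  refine denseRange_ofSchwartz.induction_on₂ (p := fun f g ↦ toDistribution (B f g) =
    (mulLp (toLp hs f) (toLp hs g) : 𝓢'(ℝ, ℂ))) ?_ (fun φ ψ ↦ ?_) f g
  · refine isClosed_eq ?_ ?_
    · have h : Continuous fun q : Sobolev s × Sobolev s ↦ B q.1 q.2 := by fun_prop
      exact continuous_toDistribution.comp h
    · have h : Continuous fun q : Sobolev s × Sobolev s ↦
          mulLp (toLp hs q.1) (toLp hs q.2) := by fun_prop
      exact (Lp.toTemperedDistributionCLM ℂ (volume : Measure ℝ) 1).continuous.comp h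
  · rw [hB, toLp_ofSchwartz, toLp_ofSchwartz]
    ext χ
    rw [LinearMap.comp_apply, toDistribution_ofSchwartz, Lp.toTemperedDistribution_apply]
    refine (SchwartzMap.coe_apply (mul φ ψ) χ).trans (integral_congr_ae ?_)
    filter_upwards [mulLp_ae_eq (φ.toLp 2) (ψ.toLp 2), φ.coeFn_toLp 2 volume,
      ψ.coeFn_toLp 2 volume] with x h1 h2 h3
    rw [h1, h2, h3]
    rfl

/-- The distribution `f + f² / 2`, for an element `f` of `H ^ s` that is a real function. -/
theorem eq_toDistribution_add_mul (hs : 0 ≤ s) (hr : r ≤ s)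
    {B : Sobolev s →L[ℂ] Sobolev s →L[ℂ] Sobolev r}
    (hB : ∀ f g, toDistribution (B f g) =
      (mulLp (toLp hs f) (toLp hs g) : 𝓢'(ℝ, ℂ)))
    {f : Sobolev s} {u : ℝ → ℝ} (hf : IsFunction (toDistribution f) u) {N : 𝓢'(ℝ, ℂ)}
    (hN : IsFunction N fun x ↦ u x + u x ^ 2 / 2) :
    N = toDistribution (inclusion hr f + (1 / 2 : ℂ) • B f f) := by
  have hu := toLp_ae_eq hs hf
  ext ψ
  have h2 : Integrable fun x ↦ ψ x * ((u x ^ 2 / 2 : ℝ) : ℂ) := by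
    refine ((hN ψ).1.sub (hf ψ).1).congr (.of_forall fun x ↦ ?_)
    simp only [Pi.sub_apply]
    push_cast
    ring
  have h3 : toDistribution (B f f) ψ = ∫ x, ψ x * ((u x ^ 2 : ℝ) : ℂ) := by
    rw [hB, Lp.toTemperedDistribution_apply]
    refine integral_congr_ae ?_
    filter_upwards [mulLp_ae_eq (toLp hs f) (toLp hs f), hu] with x h1 h2
    rw [h1, h2, smul_eq_mul]
    push_cast
    ring
  rw [map_add, map_smul, toDistribution_inclusion]
  change N ψ = toDistribution f ψ + (1 / 2 : ℂ) * toDistribution (B f f) ψ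
  rw [h3, (hf ψ).2, (hN ψ).2, ← integral_const_mul, ← integral_add (hf ψ).1]
  · refine integral_congr_ae (.of_forall fun x ↦ ?_)
    simp only
    push_cast
    ring
  · refine h2.congr (.of_forall fun x ↦ ?_)
    simp only
    push_cast
    ring

variable (s) in
/-- The pairing of an element of `H ^ s` with a Schwartz function, as a real linear functional. -/
def eval (ψ : 𝓢(ℝ, ℂ)) : Sobolev s →L[ℝ] ℂ where
  toFun f := toDistribution f ψ
  map_add' f g := by
    rw [map_add]
    rfl
  map_smul' c f := by
    change toDistribution ((c : ℂ) • f) ψ = _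
    rw [map_smul]
    rfl
  cont := (PointwiseConvergenceCLM.evalCLM (RingHom.id ℂ) ℂ ψ).continuous.comp
    continuous_toDistribution

theorem eval_apply (ψ : 𝓢(ℝ, ℂ)) (f : Sobolev s) : eval s ψ f = toDistribution f ψ := rfl

end Sobolev

/-! ### Smoothing in Sobolev spaces -/

/-- With values in `H ^ (r + 1)` the right-hand side of the equation is a smooth function of
`u ∈ H ^ s`; the condition `s ≤ r + 1` lets the gain in regularity be fed back into the equation. -/
theorem contDiffInSobolev_of_lt {s T r σ : ℝ} {u₀ : ℝ → ℝ} {u : ℝ → ℝ → ℝ} (hs : 0 ≤ s)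
    (hT : 0 < T) (hu : ContDiffInSobolev 0 T s u) (hsol : IsSolution T u₀ u) (hr : r ≤ s)
    (hrs : r < 2 * s - 1 / 2) (hsr : s ≤ r + 1) (hσ : σ ≤ r + 1) :
    ContDiffInSobolev ∞ T σ (fun t x ↦ u t x - u₀ x) := by
  obtain ⟨U, hUc, hU⟩ := hu
  obtain ⟨D, N, heq⟩ := hsol.equation
  obtain ⟨B, hB⟩ := Sobolev.exists_mul hs hr hrs
  let F : Sobolev s → Sobolev (r + 1) := fun f ↦
    -Sobolev.smoothing r (Sobolev.inclusion hr f + (1 / 2 : ℂ) • B f f)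
  have hF : ContDiff ℝ ∞ F := by
    have hF' : ContDiff ℂ ∞ F := by
      refine ((Sobolev.smoothing r).contDiff.comp ?_).neg
      exact (Sobolev.inclusion hr).contDiff.add
        ((B.contDiff.clm_apply contDiff_id).const_smul (1 / 2 : ℂ))
    exact hF'.restrict_scalars ℝ
  have h0 : (0 : ℝ) ∈ Icc (-T) T := ⟨by linarith, hT.le⟩
  have hDU : ∀ t ∈ Icc (-T) T, D t = (U t).toDistribution := fun t ht ↦
    (heq t ht).1.distribution_unique (hU t ht)
  obtain ⟨V, hV, hVU⟩ := exists_contDiffOn_lift_of_weak_ode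
    ((Sobolev.inclusion hsr).restrictScalars ℝ) hF hT hUc.continuousOn (Sobolev.eval s)
    (fun x hx ↦ Sobolev.toDistribution_injective (by
      ext ψ
      rw [map_zero]
      exact hx ψ))
    (fun t ht ψ ↦ by
      have h := (heq t ht).2.2 ψ
      rw [Sobolev.eq_toDistribution_add_mul hs hr hB (hU t ht) (heq t ht).2.1,
        ← Sobolev.toDistribution_smoothing] at h
      have h1 : HasDerivWithinAt (fun τ ↦ Sobolev.eval s ψ (U τ)) _ (Icc (-T) T) t :=
        h.congr (fun τ hτ ↦ by rw [Sobolev.eval_apply, hDU τ hτ])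
          (by rw [Sobolev.eval_apply, hDU t ht])
      convert! h1 using 1)
  refine ⟨fun t ↦ Sobolev.inclusion hσ (V t),
    ((Sobolev.inclusion hσ).restrictScalars ℝ).contDiff.comp_contDiffOn hV, fun t ht ↦ ?_⟩
  have h1 : (V t).toDistribution = (U t).toDistribution - (U 0).toDistribution := by
    rw [← map_sub, ← hVU t ht]
    exact (Sobolev.toDistribution_inclusion hsr (V t)).symm
  rw [Sobolev.toDistribution_inclusion, h1]
  exact (hU t ht).sub ((hU 0 h0).congr_ae hsol.initial)

/-! ### Hölder spaces as Banach spaces -/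

theorem memHolder_zero_iff {θ : ℝ} {f : ℝ → ℝ} : MemHolder 0 θ f ↔ Continuous f ∧
    (∃ C : ℝ, ∀ x, |f x| ≤ C) ∧ ∃ C : ℝ, ∀ x h : ℝ, |f (x + h) - f x| ≤ C * |h| ^ θ := by
  simp [MemHolder, contDiff_zero]

theorem memHolder_succ_iff {k : ℕ} {θ : ℝ} {f : ℝ → ℝ} : MemHolder (k + 1) θ f ↔
    Differentiable ℝ f ∧ (∃ C : ℝ, ∀ x, |f x| ≤ C) ∧ MemHolder k θ (deriv f) := by
  have h1 : ContDiff ℝ ((k + 1 : ℕ) : WithTop ℕ∞) f ↔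
      Differentiable ℝ f ∧ ContDiff ℝ k (deriv f) := by
    push_cast
    rw [contDiff_succ_iff_deriv]
    simp
  simp only [MemHolder, h1, iteratedDeriv_succ']
  constructor
  · rintro ⟨⟨h2, h3⟩, h4, h5⟩
    exact ⟨h2, by simpa using h4 0 (by simp), h3,
      fun j hj ↦ by simpa [iteratedDeriv_succ'] using h4 (j + 1) (by simpa using hj), h5⟩
  · rintro ⟨h2, h3, h4, h5, h6⟩
    refine ⟨⟨h2, h4⟩, fun j hj ↦ ?_, h6⟩
    rcases j with - | j
    · simpa using h3
    · simpa [iteratedDeriv_succ'] using h5 j (by simpa using hj)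

namespace MemHolder

variable {k : ℕ} {θ : ℝ} {f g : ℝ → ℝ}

theorem continuous (hf : MemHolder k θ f) : Continuous f := hf.1.continuous

theorem bounded (hf : MemHolder k θ f) : ∃ C : ℝ, ∀ x, |f x| ≤ C := by
  simpa using hf.2.1 0 (Nat.zero_le k)

theorem add (hf : MemHolder k θ f) (hg : MemHolder k θ g) : MemHolder k θ (f + g) :=
  (holderSubmodule k θ).add_mem hf hg

theorem sub (hf : MemHolder k θ f) (hg : MemHolder k θ g) : MemHolder k θ (f - g) :=
  (holderSubmodule k θ).sub_mem hf hg

theorem smul (c : ℝ) (hf : MemHolder k θ f) : MemHolder k θ (c • f) :=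
  (holderSubmodule k θ).smul_mem c hf

/-- A bounded function with bounded derivative is Hölder continuous of every exponent in `[0, 1]`:
use the bound on the derivative for `|h| ≤ 1` and the bound on the function for `1 ≤ |h|`. -/
theorem zero_of_bounded_deriv (h0 : 0 ≤ θ) (h1 : θ ≤ 1) (hd : Differentiable ℝ f)
    (hf : ∃ C : ℝ, ∀ x, |f x| ≤ C) (hf' : ∃ C : ℝ, ∀ x, |deriv f x| ≤ C) : MemHolder 0 θ f := by
  refine memHolder_zero_iff.2 ⟨hd.continuous, hf, ?_⟩
  obtain ⟨A, hA⟩ := hf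
  obtain ⟨B, hB⟩ := hf'
  have hA0 : 0 ≤ A := (abs_nonneg _).trans (hA 0)
  have hB0 : 0 ≤ B := (abs_nonneg _).trans (hB 0)
  refine ⟨2 * A + B, fun x h ↦ ?_⟩
  rcases le_total |h| 1 with hh | hh
  · have h2 : |f (x + h) - f x| ≤ B * |x + h - x| :=
      convex_univ.norm_image_sub_le_of_norm_deriv_le (fun y _ ↦ hd y) (fun y _ ↦ hB y)
        (mem_univ x) (mem_univ (x + h))
    rw [add_sub_cancel_left] at h2
    have h3 : |h| ≤ |h| ^ θ := by
      rcases (abs_nonneg h).eq_or_lt with h4 | h4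
      · rw [← h4]
        exact Real.rpow_nonneg le_rfl θ
      · simpa using Real.rpow_le_rpow_of_exponent_ge h4 hh h1
    calc |f (x + h) - f x| ≤ B * |h| := h2
      _ ≤ (2 * A + B) * |h| ^ θ := by gcongr; linarith
  · have h2 : |f (x + h) - f x| ≤ A + A := (abs_sub _ _).trans (add_le_add (hA _) (hA _))
    have h3 : 1 ≤ |h| ^ θ := Real.one_le_rpow hh h0
    calc |f (x + h) - f x| ≤ (2 * A + B) * 1 := by linarith
      _ ≤ (2 * A + B) * |h| ^ θ := by gcongr

theorem of_succ (h0 : 0 ≤ θ) (h1 : θ ≤ 1) (hf : MemHolder (k + 1) θ f) : MemHolder k θ f := by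
  induction k generalizing f with
  | zero =>
    obtain ⟨h2, h3, h4⟩ := memHolder_succ_iff.1 hf
    exact zero_of_bounded_deriv h0 h1 h2 h3 h4.bounded
  | succ k ih =>
    obtain ⟨h2, h3, h4⟩ := memHolder_succ_iff.1 hf
    exact memHolder_succ_iff.2 ⟨h2, h3, ih h4⟩

theorem mul (h0 : 0 ≤ θ) (h1 : θ ≤ 1) (hf : MemHolder k θ f) (hg : MemHolder k θ g) :
    MemHolder k θ (f * g) := by
  induction k generalizing f g with
  | zero =>
    obtain ⟨hfc, ⟨A, hA⟩, A', hA'⟩ := memHolder_zero_iff.1 hf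
    obtain ⟨hgc, ⟨B, hB⟩, B', hB'⟩ := memHolder_zero_iff.1 hg
    have hA0 : 0 ≤ A := (abs_nonneg _).trans (hA 0)
    refine memHolder_zero_iff.2 ⟨hfc.mul hgc, ⟨A * B, fun x ↦ ?_⟩, A * B' + A' * B, fun x h ↦ ?_⟩
    · rw [Pi.mul_apply, abs_mul]
      exact mul_le_mul (hA x) (hB x) (abs_nonneg _) hA0
    · have h2 : (f * g) (x + h) - (f * g) x =
          f (x + h) * (g (x + h) - g x) + (f (x + h) - f x) * g x := by
        simp only [Pi.mul_apply]
        ring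
      rw [h2]
      refine (abs_add_le _ _).trans ?_
      rw [abs_mul, abs_mul]
      calc _ ≤ A * (B' * |h| ^ θ) + (A' * |h| ^ θ) * B :=
            add_le_add (mul_le_mul (hA _) (hB' _ _) (abs_nonneg _) hA0)
              (mul_le_mul (hA' _ _) (hB _) (abs_nonneg _) ((abs_nonneg _).trans (hA' x h)))
        _ = _ := by ring
  | succ k ih =>
    obtain ⟨hfd, ⟨A, hA⟩, hf'⟩ := memHolder_succ_iff.1 hf
    obtain ⟨hgd, ⟨B, hB⟩, hg'⟩ := memHolder_succ_iff.1 hg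
    have hd : deriv (f * g) = deriv f * g + f * deriv g := by
      ext x
      exact deriv_mul (hfd x) (hgd x)
    refine memHolder_succ_iff.2 ⟨hfd.mul hgd, ⟨A * B, fun x ↦ ?_⟩, ?_⟩
    · rw [Pi.mul_apply, abs_mul]
      exact mul_le_mul (hA x) (hB x) (abs_nonneg _) ((abs_nonneg _).trans (hA x))
    · rw [hd]
      exact (ih hf' (hg.of_succ h0 h1)).add (ih (hf.of_succ h0 h1) hg')

theorem comp_neg (hf : MemHolder k θ f) : MemHolder k θ (fun x ↦ f (-x)) := by
  induction k generalizing f with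
  | zero =>
    obtain ⟨hfc, ⟨A, hA⟩, A', hA'⟩ := memHolder_zero_iff.1 hf
    refine memHolder_zero_iff.2 ⟨hfc.comp continuous_neg, ⟨A, fun x ↦ hA _⟩, A', fun x h ↦ ?_⟩
    rw [neg_add, ← abs_neg h]
    exact hA' _ _
  | succ k ih =>
    obtain ⟨hfd, ⟨A, hA⟩, hf'⟩ := memHolder_succ_iff.1 hf
    refine memHolder_succ_iff.2 ⟨hfd.comp differentiable_neg, ⟨A, fun x ↦ hA _⟩, ?_⟩
    have h1 : deriv (fun x ↦ f (-x)) = (-1 : ℝ) • fun x ↦ deriv f (-x) := by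
      ext x
      rw [deriv_comp_neg]
      simp
    rw [h1]
    exact (ih hf').smul _

end MemHolder

namespace Holder

variable {k : ℕ} {θ : ℝ}

/-- A function of class `C ^ {k, θ}` as an element of the space. -/
def ofMem {f : ℝ → ℝ} (hf : MemHolder k θ f) : Holder k θ := ⟨f, hf⟩

/-- The values that enter the norm of `C ^ {k, θ}`: derivatives of order `j ≤ k` at a point, and
difference quotients of the derivative of order `k`. -/
def value (k : ℕ) (θ : ℝ) : Fin (k + 1) × ℝ ⊕ ℝ × {h : ℝ // h ≠ 0} → Holder k θ →ₗ[ℝ] ℝ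
  | .inl i =>
    { toFun f := iteratedDeriv i.1 f.toFun i.2
      map_add' f g := by
        rw [map_add, iteratedDeriv_add_apply (Nat.lt_succ_iff.1 i.1.2) f.memHolder.1 g.memHolder.1]
      map_smul' c f := by
        rw [map_smul, iteratedDeriv_smul_apply (Nat.lt_succ_iff.1 i.1.2) c f.memHolder.1]
        rfl }
  | .inr p =>
    { toFun f := quotient k θ f.toFun p
      map_add' f g := by
        rw [map_add]
        simp only [quotient]
        rw [iteratedDeriv_add_apply le_rfl f.memHolder.1 g.memHolder.1,
          iteratedDeriv_add_apply le_rfl f.memHolder.1 g.memHolder.1]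
        ring
      map_smul' c f := by
        rw [map_smul]
        simp only [quotient]
        rw [iteratedDeriv_smul_apply le_rfl c f.memHolder.1,
          iteratedDeriv_smul_apply le_rfl c f.memHolder.1, RingHom.id_apply, smul_eq_mul]
        ring }

theorem value_inl (j : Fin (k + 1)) (x : ℝ) (f : Holder k θ) :
    value k θ (.inl (j, x)) f = iteratedDeriv j f.toFun x := rfl

theorem value_inr (p : ℝ × {h : ℝ // h ≠ 0}) (f : Holder k θ) :
    value k θ (.inr p) f = quotient k θ f.toFun p := rfl

theorem abs_value_le (i : Fin (k + 1) × ℝ ⊕ ℝ × {h : ℝ // h ≠ 0}) (f : Holder k θ) :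
    |value k θ i f| ≤ ‖f‖ := by
  have h1 : ∀ j ∈ Finset.range (k + 1), 0 ≤ ⨆ x : ℝ, |iteratedDeriv j f.toFun x| :=
    fun _ _ ↦ Real.iSup_nonneg fun _ ↦ abs_nonneg _
  have h2 : 0 ≤ ⨆ p, |quotient k θ f.toFun p| := Real.iSup_nonneg fun _ ↦ abs_nonneg _
  rw [norm_def]
  rcases i with ⟨j, x⟩ | p
  · have h3 := le_ciSup (f.bddAbove_deriv (Nat.lt_succ_iff.1 j.2)) x
    have h4 := Finset.single_le_sum h1 (Finset.mem_range.2 j.2)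
    rw [value_inl]
    linarith
  · have h3 := le_ciSup f.bddAbove_quotient p
    have h4 := Finset.sum_nonneg h1
    rw [value_inr]
    linarith

theorem norm_le_of_forall_value {f : Holder k θ} {c : ℝ} (h : ∀ i, |value k θ i f| ≤ c) :
    ‖f‖ ≤ (k + 2) * c := by
  have : Nonempty (ℝ × {h : ℝ // h ≠ 0}) := ⟨(0, ⟨1, one_ne_zero⟩)⟩
  rw [norm_def]
  have h1 : ∀ j ∈ Finset.range (k + 1), (⨆ x : ℝ, |iteratedDeriv j f.toFun x|) ≤ c :=
    fun j hj ↦ ciSup_le fun x ↦ h (.inl (⟨j, Finset.mem_range.1 hj⟩, x))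
  have h2 : (⨆ p, |quotient k θ f.toFun p|) ≤ c := ciSup_le fun p ↦ h (.inr p)
  have h3 := Finset.sum_le_card_nsmul _ _ _ h1
  simp only [Finset.card_range, nsmul_eq_mul, Nat.cast_add, Nat.cast_one] at h3
  linarith

/-- The limit of a Cauchy sequence is found from the uniform limits of the derivatives of order at
most `k`. -/
instance : CompleteSpace (Holder k θ) := by
  refine Metric.complete_of_cauchySeq_tendsto fun f hf ↦ ?_
  have hcauchy : ∀ ε > 0, ∃ N, ∀ n ≥ N, ∀ m ≥ N, ∀ i,
      |value k θ i (f n) - value k θ i (f m)| ≤ ε := by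
    intro ε hε
    obtain ⟨N, hN⟩ := Metric.cauchySeq_iff.1 hf ε hε
    refine ⟨N, fun n hn m hm i ↦ ?_⟩
    rw [← map_sub]
    exact (abs_value_le i _).trans (by simpa [dist_eq_norm] using (hN n hn m hm).le)
  have hlim : ∀ i, ∃ y, Tendsto (fun n ↦ value k θ i (f n)) atTop (𝓝 y) := by
    intro i
    refine cauchySeq_tendsto_of_complete (Metric.cauchySeq_iff.2 fun ε hε ↦ ?_)
    obtain ⟨N, hN⟩ := hcauchy (ε / 2) (by positivity)
    exact ⟨N, fun n hn m hm ↦ (hN n hn m hm i).trans_lt (by linarith)⟩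
  choose y hy using hlim
  have hunif : ∀ ε > 0, ∃ N, ∀ n ≥ N, ∀ i, |value k θ i (f n) - y i| ≤ ε := by
    intro ε hε
    obtain ⟨N, hN⟩ := hcauchy ε hε
    refine ⟨N, fun n hn i ↦ ?_⟩
    refine le_of_tendsto ((tendsto_const_nhds.sub (hy i)).abs) ?_
    filter_upwards [eventually_ge_atTop N] with m hm using hN n hn m hm i
  set D : ℕ → ℝ → ℝ := fun j x ↦ if hj : j < k + 1 then y (.inl (⟨j, hj⟩, x)) else 0 with hD
  have hDy : ∀ j (hj : j < k + 1) x, D j x = y (.inl (⟨j, hj⟩, x)) := fun j hj x ↦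
    dif_pos hj
  have hDlim : ∀ j < k + 1, ∀ x,
      Tendsto (fun n ↦ iteratedDeriv j (f n).toFun x) atTop (𝓝 (D j x)) := fun j hj x ↦ by
    rw [hDy j hj]
    exact hy (.inl (⟨j, hj⟩, x))
  have hDunif : ∀ j < k + 1,
      TendstoUniformly (fun n x ↦ iteratedDeriv j (f n).toFun x) (D j) atTop := by
    intro j hj
    refine Metric.tendstoUniformly_iff.2 fun ε hε ↦ ?_
    obtain ⟨N, hN⟩ := hunif (ε / 2) (by positivity)
    filter_upwards [eventually_ge_atTop N] with n hn x
    rw [dist_comm, hDy j hj]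
    exact (hN n hn (.inl (⟨j, hj⟩, x))).trans_lt (by linarith)
  have hDcont : ∀ j < k + 1, Continuous (D j) := fun j hj ↦
    (hDunif j hj).continuous (Frequently.of_forall fun n ↦
      (f n).memHolder.1.continuous_iteratedDeriv j
        (by exact_mod_cast Nat.lt_succ_iff.1 hj))
  have hDderiv : ∀ j < k, ∀ x, HasDerivAt (D j) (D (j + 1) x) x := fun j hj x ↦ by
    refine hasDerivAt_of_tendstoUniformly (hDunif (j + 1) (by lia)) (.of_forall fun n z ↦ ?_)
      (hDlim j (by lia)) x
    rw [iteratedDeriv_succ]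
    exact ((f n).memHolder.1.differentiable_iteratedDeriv j (by exact_mod_cast hj) z).hasDerivAt
  have hDiter : ∀ j < k + 1, iteratedDeriv j (D 0) = D j := by
    intro j hj
    induction j with
    | zero => exact iteratedDeriv_zero
    | succ j ih =>
      rw [iteratedDeriv_succ, ih (by lia)]
      ext x
      exact (hDderiv j (by lia) x).deriv
  obtain ⟨M, hM⟩ := hf.norm_bddAbove
  have hyM : ∀ i, |y i| ≤ M := fun i ↦ le_of_tendsto (hy i).abs (.of_forall fun n ↦
    (abs_value_le i (f n)).trans (hM ⟨n, rfl⟩))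
  have hquot : ∀ p, quotient k θ (D 0) p = y (.inr p) := fun p ↦ by
    refine tendsto_nhds_unique ?_ (hy (.inr p))
    simp only [value_inr, quotient, hDiter k (by lia)]
    exact ((hDlim k (by lia) _).sub (hDlim k (by lia) _)).div_const _
  have hmem : MemHolder k θ (D 0) := by
    refine ⟨contDiff_iff_iteratedDeriv.2 ⟨fun m hm ↦ ?_, fun m hm ↦ ?_⟩, fun j hj ↦
      ⟨M, fun x ↦ ?_⟩, M, fun x h ↦ ?_⟩
    · have hm' : m < k + 1 := Nat.lt_succ_iff.2 (by exact_mod_cast hm)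
      rw [hDiter m hm']
      exact hDcont m hm'
    · have hm' : m < k := by exact_mod_cast hm
      rw [hDiter m (by lia)]
      exact fun x ↦ (hDderiv m hm' x).differentiableAt
    · rw [hDiter j (by lia), hDy j (by lia)]
      exact hyM _
    · by_cases hh : h = 0
      · subst hh
        simpa using mul_nonneg ((norm_nonneg (f 0)).trans (hM ⟨0, rfl⟩))
          (Real.rpow_nonneg le_rfl θ)
      · have h1 := hyM (.inr (x, ⟨h, hh⟩))
        have h2 : 0 < |h| ^ θ := Real.rpow_pos_of_pos (abs_pos.2 hh) θ
        rw [← hquot, quotient, abs_div, abs_of_pos h2, div_le_iff₀ h2] at h1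
        exact h1
  refine ⟨ofMem hmem, Metric.tendsto_atTop.2 fun ε hε ↦ ?_⟩
  have hval : ∀ i, value k θ i (ofMem hmem) = y i := by
    rintro (⟨j, x⟩ | p)
    · rw [← hDy j j.2, ← hDiter j j.2]
      rfl
    · exact hquot p
  obtain ⟨N, hN⟩ := hunif (ε / (2 * (k + 2))) (by positivity)
  refine ⟨N, fun n hn ↦ ?_⟩
  rw [dist_eq_norm]
  refine (norm_le_of_forall_value (c := ε / (2 * (k + 2))) fun i ↦ ?_).trans_lt ?_
  · rw [map_sub, hval]
    exact hN n hn i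
  · field_simp
    linarith

theorem abs_toFun_le (f : Holder k θ) (x : ℝ) : |f.toFun x| ≤ ‖f‖ := by
  simpa [value_inl] using abs_value_le (.inl (0, x)) f

theorem continuous_toFun_apply (x : ℝ) : Continuous fun f : Holder k θ ↦ f.toFun x :=
  AddMonoidHomClass.continuous_of_bound
    ((LinearMap.proj (R := ℝ) (φ := fun _ : ℝ ↦ ℝ) x).comp (toFun (k := k) (θ := θ))) 1
    fun f ↦ by simpa using f.abs_toFun_le x

/-- A linear map into `C ^ {k, θ}` that is continuous at each point is bounded, by the closed graph
theorem. -/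
theorem continuous_of_continuous_apply {E : Type*} [NormedAddCommGroup E] [NormedSpace ℝ E]
    [CompleteSpace E] (A : E →ₗ[ℝ] Holder k θ)
    (hA : ∀ x, Continuous fun f ↦ (A f).toFun x) : Continuous A := by
  refine A.continuous_of_seq_closed_graph fun u x y hu hy ↦ toFun_injective (funext fun z ↦ ?_)
  exact tendsto_nhds_unique (((continuous_toFun_apply z).tendsto y).comp hy)
    (((hA z).tendsto x).comp hu)

/-- The inclusion of `C ^ {k + 1, θ}` into `C ^ {k, θ}`. -/
def inclusion (h0 : 0 ≤ θ) (h1 : θ ≤ 1) : Holder (k + 1) θ →L[ℝ] Holder k θ :=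
  let A : Holder (k + 1) θ →ₗ[ℝ] Holder k θ :=
    { toFun f := ofMem (f.memHolder.of_succ h0 h1)
      map_add' _ _ := rfl
      map_smul' _ _ := rfl }
  ⟨A, continuous_of_continuous_apply A continuous_toFun_apply⟩

@[simp]
theorem toFun_inclusion (h0 : 0 ≤ θ) (h1 : θ ≤ 1) (f : Holder (k + 1) θ) :
    (inclusion h0 h1 f).toFun = f.toFun := rfl

/-- Multiplication by a fixed element of `C ^ {k, θ}`. -/
def mulLeft (h0 : 0 ≤ θ) (h1 : θ ≤ 1) (f : Holder k θ) : Holder k θ →L[ℝ] Holder k θ :=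
  let A : Holder k θ →ₗ[ℝ] Holder k θ :=
    { toFun g := ofMem (f.memHolder.mul h0 h1 g.memHolder)
      map_add' g g' := toFun_injective (mul_add f.toFun g.toFun g'.toFun)
      map_smul' c g := toFun_injective (mul_smul_comm c f.toFun g.toFun) }
  ⟨A, continuous_of_continuous_apply A fun x ↦ continuous_const.mul (continuous_toFun_apply x)⟩

/-- Multiplication in `C ^ {k, θ}` as a bounded bilinear map. -/
def mul (h0 : 0 ≤ θ) (h1 : θ ≤ 1) : Holder k θ →L[ℝ] Holder k θ →L[ℝ] Holder k θ :=
  let A : Holder k θ →ₗ[ℝ] Holder k θ →L[ℝ] Holder k θ :=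
    { toFun := mulLeft h0 h1
      map_add' f f' := ContinuousLinearMap.ext fun g ↦
        toFun_injective (add_mul f.toFun f'.toFun g.toFun)
      map_smul' c f := ContinuousLinearMap.ext fun g ↦
        toFun_injective (smul_mul_assoc c f.toFun g.toFun) }
  ⟨A, A.continuous_of_seq_closed_graph fun u f P hu hP ↦ by
    refine ContinuousLinearMap.ext fun g ↦ toFun_injective (funext fun x ↦ ?_)
    have h2 : Tendsto (fun n ↦ (A (u n) g).toFun x) atTop (𝓝 ((P g).toFun x)) :=
      ((continuous_toFun_apply x).tendsto _).comp
        (((ContinuousLinearMap.apply ℝ (Holder k θ) g).continuous.tendsto P).comp hP)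
    have h3 : Tendsto (fun n ↦ (u n).toFun x * g.toFun x) atTop (𝓝 (f.toFun x * g.toFun x)) :=
      (((continuous_toFun_apply x).tendsto f).comp hu).mul_const _
    exact tendsto_nhds_unique h2 h3⟩

theorem toFun_mul (h0 : 0 ≤ θ) (h1 : θ ≤ 1) (f g : Holder k θ) :
    (mul h0 h1 f g).toFun = f.toFun * g.toFun := rfl

end Holder

/-! ### The operator `(1 - ∂ₓ²)⁻¹ ∂ₓ` on bounded continuous functions -/

/-- The bounded solution `x ↦ ∫_{-∞}^x e ^ (y - x) f(y) dy` of `a' + a = f`. -/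
def expIntegral (f : ℝ → ℝ) (x : ℝ) : ℝ := ∫ y in Iic x, Real.exp (y - x) * f y

/-- The bounded solution `x ↦ ∫_x^∞ e ^ (x - y) f(y) dy` of `b - b' = f`, as a reflection of
`expIntegral`. -/
def expIntegral' (f : ℝ → ℝ) (x : ℝ) : ℝ := expIntegral (fun y ↦ f (-y)) (-x)

/-- The derivative of the convolution of `f` with the kernel `e ^ (-|x|) / 2` of `(1 - ∂ₓ²)⁻¹`. -/
def smoothingFun (f : ℝ → ℝ) (x : ℝ) : ℝ := (expIntegral' f x - expIntegral f x) / 2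

section ExpIntegral

variable {f g : ℝ → ℝ} {C : ℝ}

theorem expIntegral_eq (f : ℝ → ℝ) (x : ℝ) :
    expIntegral f x = Real.exp (-x) * ∫ y in Iic x, Real.exp y * f y := by
  rw [expIntegral, ← integral_const_mul]
  refine integral_congr_ae (.of_forall fun y ↦ ?_)
  simp only [sub_eq_add_neg, Real.exp_add]
  ring

theorem integrableOn_exp_mul (hf : Continuous f) (hC : ∀ x, |f x| ≤ C) (x : ℝ) :
    IntegrableOn (fun y ↦ Real.exp y * f y) (Iic x) :=
  (integrableOn_exp_Iic x).mul_bdd hf.aestronglyMeasurable (.of_forall hC)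

theorem abs_expIntegral_le (hf : Continuous f) (hC : ∀ x, |f x| ≤ C) (x : ℝ) :
    |expIntegral f x| ≤ C := by
  have h1 : |∫ y in Iic x, Real.exp y * f y| ≤ ∫ y in Iic x, Real.exp y * C := by
    refine (abs_integral_le_integral_abs).trans ?_
    refine integral_mono (integrableOn_exp_mul hf hC x).abs
      ((integrableOn_exp_Iic x).mul_const C) fun y ↦ ?_
    simp only [abs_mul, Real.abs_exp]
    exact mul_le_mul_of_nonneg_left (hC y) (Real.exp_pos y).le
  rw [integral_mul_const, integral_exp_Iic] at h1
  rw [expIntegral_eq, abs_mul, Real.abs_exp]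
  calc Real.exp (-x) * |∫ y in Iic x, Real.exp y * f y| ≤ Real.exp (-x) * (Real.exp x * C) := by
        gcongr
    _ = C := by rw [← mul_assoc, ← Real.exp_add]; simp

theorem hasDerivAt_expIntegral (hf : Continuous f) (hC : ∀ x, |f x| ≤ C) (x : ℝ) :
    HasDerivAt (expIntegral f) (f x - expIntegral f x) x := by
  have hc : Continuous fun y ↦ Real.exp y * f y := Real.continuous_exp.mul hf
  have h1 : (fun x ↦ ∫ y in Iic x, Real.exp y * f y) =
      fun x ↦ (∫ y in Iic (0 : ℝ), Real.exp y * f y) + ∫ y in (0 : ℝ)..x, Real.exp y * f y := by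
    ext x
    rw [← intervalIntegral.integral_Iic_sub_Iic (integrableOn_exp_mul hf hC 0)
      (integrableOn_exp_mul hf hC x)]
    ring
  have h2 : HasDerivAt (fun x ↦ ∫ y in Iic x, Real.exp y * f y) (Real.exp x * f x) x := by
    rw [h1]
    exact (hc.integral_hasStrictDerivAt 0 x).hasDerivAt.const_add _
  have h3 : HasDerivAt (fun x ↦ Real.exp (-x)) (-Real.exp (-x)) x := by
    simpa using (hasDerivAt_neg x).exp
  have h4 := h3.mul h2
  rw [show expIntegral f = fun x ↦ _ from funext (expIntegral_eq f)]
  convert! h4 using 1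
  rw [← mul_assoc, ← Real.exp_add]
  simp
  ring

theorem hasDerivAt_expIntegral' (hf : Continuous f) (hC : ∀ x, |f x| ≤ C) (x : ℝ) :
    HasDerivAt (expIntegral' f) (expIntegral' f x - f x) x := by
  have h := (hasDerivAt_expIntegral (hf.comp continuous_neg) (fun x ↦ hC (-x)) (-x)).comp x
    (hasDerivAt_neg x)
  convert! h using 1
  simp [expIntegral', Function.comp_def]

theorem abs_expIntegral'_le (hf : Continuous f) (hC : ∀ x, |f x| ≤ C) (x : ℝ) :
    |expIntegral' f x| ≤ C :=
  abs_expIntegral_le (hf.comp continuous_neg) (fun x ↦ hC (-x)) (-x)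

theorem abs_smoothingFun_le (hf : Continuous f) (hC : ∀ x, |f x| ≤ C) (x : ℝ) :
    |smoothingFun f x| ≤ C := by
  have h1 := abs_le.1 (abs_expIntegral_le hf hC x)
  have h2 := abs_le.1 (abs_expIntegral'_le hf hC x)
  rw [smoothingFun, abs_le]
  constructor <;> linarith

theorem expIntegral_add (hf : Continuous f) (hC : ∃ C : ℝ, ∀ x, |f x| ≤ C) (hg : Continuous g)
    (hD : ∃ C : ℝ, ∀ x, |g x| ≤ C) (x : ℝ) :
    expIntegral (f + g) x = expIntegral f x + expIntegral g x := by
  obtain ⟨C, hC⟩ := hC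
  obtain ⟨D, hD⟩ := hD
  simp only [expIntegral_eq, Pi.add_apply, mul_add]
  rw [integral_add (integrableOn_exp_mul hf hC x) (integrableOn_exp_mul hg hD x), mul_add]

theorem expIntegral_smul (c : ℝ) (f : ℝ → ℝ) (x : ℝ) :
    expIntegral (c • f) x = c * expIntegral f x := by
  rw [expIntegral, expIntegral, ← integral_const_mul]
  refine integral_congr_ae (.of_forall fun y ↦ ?_)
  simp only [Pi.smul_apply, smul_eq_mul]
  ring

theorem smoothingFun_add (hf : Continuous f) (hC : ∃ C : ℝ, ∀ x, |f x| ≤ C) (hg : Continuous g)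
    (hD : ∃ C : ℝ, ∀ x, |g x| ≤ C) : smoothingFun (f + g) = smoothingFun f + smoothingFun g := by
  ext x
  have h := expIntegral_add (hf.comp continuous_neg) (hC.imp fun _ h x ↦ h (-x))
    (hg.comp continuous_neg) (hD.imp fun _ h x ↦ h (-x)) (-x)
  simp only [smoothingFun, Pi.add_apply, expIntegral_add hf hC hg hD]
  rw [show expIntegral' (f + g) x = expIntegral' f x + expIntegral' g x from h]
  ring

theorem smoothingFun_smul (c : ℝ) (f : ℝ → ℝ) : smoothingFun (c • f) = c • smoothingFun f := by
  ext x
  have h := expIntegral_smul c (fun y ↦ f (-y)) (-x)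
  simp only [smoothingFun, Pi.smul_apply, smul_eq_mul, expIntegral_smul]
  rw [show expIntegral' (c • f) x = c * expIntegral' f x from h]
  ring

end ExpIntegral

/-- The gain of one derivative: `a' = f - a` has as many derivatives as `f` and `a` have. -/
theorem MemHolder.expIntegral {k : ℕ} {θ : ℝ} {f : ℝ → ℝ} (h0 : 0 ≤ θ) (h1 : θ ≤ 1)
    (hf : MemHolder k θ f) : MemHolder (k + 1) θ (expIntegral f) := by
  obtain ⟨C, hC⟩ := hf.bounded
  have hb : ∃ C : ℝ, ∀ x, |BBM.expIntegral f x| ≤ C :=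
    ⟨C, abs_expIntegral_le hf.continuous hC⟩
  have hd := hasDerivAt_expIntegral hf.continuous hC
  have hd' : deriv (BBM.expIntegral f) = f - BBM.expIntegral f := funext fun x ↦ (hd x).deriv
  have hdiff : Differentiable ℝ (BBM.expIntegral f) := fun x ↦ (hd x).differentiableAt
  refine memHolder_succ_iff.2 ⟨hdiff, hb, ?_⟩
  rw [hd']
  refine hf.sub ?_
  clear hd
  induction k with
  | zero =>
    refine zero_of_bounded_deriv h0 h1 hdiff hb ⟨C + C, fun x ↦ ?_⟩
    rw [hd']
    exact (abs_sub _ _).trans (add_le_add (hC x) (abs_expIntegral_le hf.continuous hC x))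
  | succ k ih =>
    have h2 := hf.of_succ h0 h1
    refine memHolder_succ_iff.2 ⟨hdiff, hb, ?_⟩
    rw [hd']
    exact h2.sub (ih h2)

theorem MemHolder.smoothingFun {k : ℕ} {θ : ℝ} {f : ℝ → ℝ} (h0 : 0 ≤ θ) (h1 : θ ≤ 1)
    (hf : MemHolder k θ f) : MemHolder (k + 1) θ (smoothingFun f) := by
  have h2 := ((hf.comp_neg.expIntegral h0 h1).comp_neg.sub (hf.expIntegral h0 h1)).smul (1 / 2)
  convert h2 using 1
  ext x
  simp only [BBM.smoothingFun, expIntegral', Pi.smul_apply, Pi.sub_apply, smul_eq_mul]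
  ring

/-- The operator `(1 - ∂ₓ²)⁻¹ ∂ₓ` from `C ^ {k, θ}` to `C ^ {k + 1, θ}`. -/
def Holder.smoothing {k : ℕ} {θ : ℝ} (h0 : 0 ≤ θ) (h1 : θ ≤ 1) :
    Holder k θ →L[ℝ] Holder (k + 1) θ :=
  let A : Holder k θ →ₗ[ℝ] Holder (k + 1) θ :=
    { toFun f := ofMem (f.memHolder.smoothingFun h0 h1)
      map_add' f g := toFun_injective (smoothingFun_add f.memHolder.continuous
        f.memHolder.bounded g.memHolder.continuous g.memHolder.bounded)
      map_smul' c f := toFun_injective (smoothingFun_smul c f.toFun) }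
  ⟨A, continuous_of_continuous_apply A fun x ↦
    AddMonoidHomClass.continuous_of_bound
      (((LinearMap.proj (R := ℝ) (φ := fun _ : ℝ ↦ ℝ) x).comp Holder.toFun).comp A) 1 fun f ↦ by
        rw [one_mul]
        exact abs_smoothingFun_le f.memHolder.continuous f.abs_toFun_le x⟩

section Distribution

variable {f f' : ℝ → ℝ} {C : ℝ}

theorem integrable_schwartz_mul (hf : Continuous f) (hC : ∀ x, |f x| ≤ C) (ψ : 𝓢(ℝ, ℂ)) :
    Integrable fun x ↦ ψ x * (f x : ℂ) :=
  ψ.integrable.mul_bdd (Complex.continuous_ofReal.comp hf).aestronglyMeasurable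
    (.of_forall fun x ↦ by simpa using hC x)

theorem exists_isFunction (hf : Continuous f) (hC : ∀ x, |f x| ≤ C) :
    ∃ F : 𝓢'(ℝ, ℂ), IsFunction F f := by
  let b : BoundedContinuousFunction ℝ ℂ := BoundedContinuousFunction.ofNormedAddCommGroup
    (fun x ↦ (f x : ℂ)) (Complex.continuous_ofReal.comp hf) C fun x ↦ by simpa using hC x
  refine ⟨((b.memLp_top (μ := volume)).toLp b : Lp ℂ ⊤ (volume : Measure ℝ)), fun ψ ↦
    ⟨integrable_schwartz_mul hf hC ψ, ?_⟩⟩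
  rw [Lp.toTemperedDistribution_apply]
  refine integral_congr_ae ?_
  filter_upwards [(b.memLp_top (μ := volume)).coeFn_toLp] with x hx
  rw [hx]
  rfl

/-- The classical derivative is the distributional one, by integration by parts. -/
theorem IsFunction.derivCLM_eq {F F' : 𝓢'(ℝ, ℂ)} (hF : IsFunction F f) (hF' : IsFunction F' f')
    (hd : ∀ x, HasDerivAt f (f' x) x) : TemperedDistribution.derivCLM ℂ F = F' := by
  ext ψ
  rw [TemperedDistribution.derivCLM_apply_apply, map_neg, (hF _).2, (hF' ψ).2]
  have h := integral_mul_deriv_eq_deriv_mul_of_integrable (u := ψ) (u' := deriv ψ)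
    (v := fun x ↦ (f x : ℂ)) (v' := fun x ↦ (f' x : ℂ))
    (fun x _ ↦ ψ.differentiableAt.hasDerivAt) (fun x _ ↦ (hd x).ofReal_comp) (hF' ψ).1
    (hF (SchwartzMap.derivCLM ℂ ℂ ψ)).1 (hF ψ).1
  rw [h]
  rfl

theorem fourierMultiplierCLM_add_apply {g₁ g₂ : ℝ → ℂ} (hg₁ : g₁.HasTemperateGrowth)
    (hg₂ : g₂.HasTemperateGrowth) (F : 𝓢'(ℝ, ℂ)) :
    TemperedDistribution.fourierMultiplierCLM ℂ (g₁ + g₂) F =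
      TemperedDistribution.fourierMultiplierCLM ℂ g₁ F +
        TemperedDistribution.fourierMultiplierCLM ℂ g₂ F := by
  simp only [TemperedDistribution.fourierMultiplierCLM_apply,
    TemperedDistribution.smulLeftCLM_add hg₁ hg₂, add_apply, FourierTransform.fourierInv_add]

/-- `J (-2)` inverts `1 - ∂ₓ²`. -/
theorem J_neg_two_sub_derivCLM_derivCLM (F : 𝓢'(ℝ, ℂ)) :
    J (-2) (F - TemperedDistribution.derivCLM ℂ (TemperedDistribution.derivCLM ℂ F)) = F := by
  have hd : ∀ F : 𝓢'(ℝ, ℂ), TemperedDistribution.derivCLM ℂ F =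
      (2 * Real.pi * Complex.I) • TemperedDistribution.fourierMultiplierCLM ℂ
        (fun ξ : ℝ ↦ ((inner ℝ ξ (1 : ℝ) : ℝ) : ℂ)) F := fun F ↦
    TemperedDistribution.lineDeriv_eq_fourierMultiplierCLM (F := ℂ) (1 : ℝ) F
  have h1 : F - TemperedDistribution.derivCLM ℂ (TemperedDistribution.derivCLM ℂ F) =
      TemperedDistribution.fourierMultiplierCLM ℂ (fun ξ : ℝ ↦ (besselSymbol 2 ξ : ℂ)) F := by
    have h2 : (fun ξ : ℝ ↦ (besselSymbol 2 ξ : ℂ)) =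
        (fun _ ↦ 1) + (-(2 * Real.pi * Complex.I) ^ 2) •
          fun ξ : ℝ ↦ ((inner ℝ ξ (1 : ℝ) : ℝ) : ℂ) * ((inner ℝ ξ (1 : ℝ) : ℝ) : ℂ) := by
      ext ξ
      simp only [besselSymbol, Pi.add_apply, Pi.smul_apply, mul_pow, Complex.I_sq, smul_eq_mul]
      norm_num
      ring
    have h3 : (fun ξ : ℝ ↦ ((inner ℝ ξ (1 : ℝ) : ℝ) : ℂ)).HasTemperateGrowth := by fun_prop
    have h4 : (fun ξ : ℝ ↦ ((inner ℝ ξ (1 : ℝ) : ℝ) : ℂ) *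
        ((inner ℝ ξ (1 : ℝ) : ℝ) : ℂ)).HasTemperateGrowth := by fun_prop
    have h5 : ((-(2 * Real.pi * Complex.I) ^ 2) • fun ξ : ℝ ↦ ((inner ℝ ξ (1 : ℝ) : ℝ) : ℂ) *
        ((inner ℝ ξ (1 : ℝ) : ℝ) : ℂ)).HasTemperateGrowth := by
      simp only [Pi.smul_def, smul_eq_mul]
      fun_prop
    rw [h2, hd (TemperedDistribution.derivCLM ℂ F), hd F, map_smul, smul_smul,
      TemperedDistribution.fourierMultiplierCLM_fourierMultiplierCLM_apply h3 h3,
      fourierMultiplierCLM_add_apply (by fun_prop) h5,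
      TemperedDistribution.fourierMultiplierCLM_const, one_smul,
      TemperedDistribution.fourierMultiplierCLM_smul h4, smul_apply, neg_smul, ← sub_eq_add_neg, sq]
    rfl
  have h2 := besselSymbol_hasTemperateGrowth 2
  have h3 := besselSymbol_hasTemperateGrowth (-2)
  rw [h1, J, TemperedDistribution.fourierMultiplierCLM_fourierMultiplierCLM_apply h2 h3]
  have h4 : ((fun ξ : ℝ ↦ (besselSymbol 2 ξ : ℂ)) * fun ξ : ℝ ↦ (besselSymbol (-2) ξ : ℂ)) =
      fun _ ↦ 1 := by
    ext ξ
    simp only [Pi.mul_apply, besselSymbol]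
    rw [← Complex.ofReal_mul, ← Real.rpow_add (by positivity)]
    norm_num
  rw [h4, TemperedDistribution.fourierMultiplierCLM_const, one_smul]
  rfl

/-- On bounded continuous functions `smoothingFun` is `(1 - ∂ₓ²)⁻¹ ∂ₓ`: with
`a = expIntegral f`, `b = expIntegral' f`, `v = (a + b) / 2`, one has `v' = smoothingFun f` and
`(1 - ∂ₓ²) v = f`. -/
theorem IsFunction.smoothingFun {N : 𝓢'(ℝ, ℂ)} (hN : IsFunction N f) (hf : Continuous f)
    (hC : ∀ x, |f x| ≤ C) :
    IsFunction (J (-2) (TemperedDistribution.derivCLM ℂ N)) (smoothingFun f) := by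
  have ha := hasDerivAt_expIntegral hf hC
  have hb := hasDerivAt_expIntegral' hf hC
  have hac : Continuous (expIntegral f) :=
    continuous_iff_continuousAt.2 fun x ↦ (ha x).continuousAt
  have hbc : Continuous (expIntegral' f) :=
    continuous_iff_continuousAt.2 fun x ↦ (hb x).continuousAt
  obtain ⟨K₁, hK₁⟩ := exists_isFunction (f := BBM.smoothingFun f)
    ((hbc.sub hac).div_const 2) (abs_smoothingFun_le hf hC)
  obtain ⟨K₀, hK₀⟩ := exists_isFunction (f := fun x ↦ (expIntegral f x + expIntegral' f x) / 2)
    (C := C) ((hac.add hbc).div_const 2) fun x ↦ by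
      have h1 := abs_le.1 (abs_expIntegral_le hf hC x)
      have h2 := abs_le.1 (abs_expIntegral'_le hf hC x)
      rw [abs_le]
      constructor <;> linarith
  have h1 : TemperedDistribution.derivCLM ℂ K₀ = K₁ := hK₀.derivCLM_eq hK₁ fun x ↦ by
    convert! ((ha x).add (hb x)).div_const 2 using 1
    simp only [BBM.smoothingFun]
    ring
  have h2 : TemperedDistribution.derivCLM ℂ K₁ = K₀ - N := hK₁.derivCLM_eq (hK₀.sub hN) fun x ↦ by
    convert! ((hb x).sub (ha x)).div_const 2 using 1
    ring
  have h3 : N = K₀ - TemperedDistribution.derivCLM ℂ K₁ := by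
    rw [h2]
    abel
  rw [h3, map_sub, h1, J_neg_two_sub_derivCLM_derivCLM]
  exact hK₁

end Distribution

namespace Holder

variable {k : ℕ} {θ : ℝ}

variable (k θ) in
/-- The pairing of an element of `C ^ {k, θ}` with a Schwartz function. -/
def eval (ψ : 𝓢(ℝ, ℂ)) : Holder k θ →L[ℝ] ℂ :=
  LinearMap.mkContinuous
    { toFun f := ∫ x, ψ x * (f.toFun x : ℂ)
      map_add' f g := by
        rw [← integral_add (integrable_schwartz_mul f.memHolder.continuous f.abs_toFun_le ψ)
          (integrable_schwartz_mul g.memHolder.continuous g.abs_toFun_le ψ)]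
        refine integral_congr_ae (.of_forall fun x ↦ ?_)
        simp [mul_add]
      map_smul' c f := by
        rw [RingHom.id_apply, ← integral_smul]
        refine integral_congr_ae (.of_forall fun x ↦ ?_)
        simp only [map_smul, Pi.smul_apply, smul_eq_mul, Complex.real_smul]
        push_cast
        ring }
    (∫ x, ‖ψ x‖) fun f ↦ by
      refine le_of_le_of_eq ?_ ((integral_const_mul ‖f‖ fun x ↦ ‖ψ x‖).trans (mul_comm _ _))
      refine norm_integral_le_of_norm_le (ψ.integrable.norm.const_mul _) (.of_forall fun x ↦ ?_)
      rw [norm_mul, Complex.norm_real, mul_comm]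
      exact mul_le_mul_of_nonneg_right (f.abs_toFun_le x) (norm_nonneg _)

theorem eval_apply (ψ : 𝓢(ℝ, ℂ)) (f : Holder k θ) :
    eval k θ ψ f = ∫ x, ψ x * (f.toFun x : ℂ) := rfl

theorem eq_zero_of_eval_eq_zero {f : Holder k θ} (h : ∀ ψ, eval k θ ψ f = 0) : f = 0 := by
  obtain ⟨F, hF⟩ := exists_isFunction f.memHolder.continuous f.abs_toFun_le
  have h1 : (fun x ↦ (f.toFun x : ℂ)) =ᵐ[volume] fun _ ↦ 0 :=
    hF.ae_eq (locallyIntegrable_const 0) fun ψ ↦ by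
      rw [(hF ψ).2]
      simpa using (eval_apply ψ f).symm.trans (h ψ)
  have h2 : f.toFun =ᵐ[volume] fun _ ↦ 0 := by
    filter_upwards [h1] with x hx
    exact_mod_cast hx
  exact toFun_injective ((f.memHolder.continuous.ae_eq_iff_eq volume continuous_const).1 h2)

end Holder

/-! ### Smoothing in Hölder spaces -/

/-- The initial value is attained everywhere, and not just almost everywhere, because `u 0` and `u₀`
are continuous. -/
theorem contDiffInHolder_succ {k : ℕ} {θ T : ℝ} {u₀ : ℝ → ℝ} {u : ℝ → ℝ → ℝ} (h0 : 0 ≤ θ)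
    (h1 : θ ≤ 1) (hT : 0 < T) (hu₀ : MemHolder k θ u₀) (hu : ContDiffInHolder 0 T k θ u)
    (hsol : IsSolution T u₀ u) :
    ContDiffInHolder ∞ T (k + 1) θ (fun t x ↦ u t x - u₀ x) := by
  obtain ⟨U, hUc, hU⟩ := hu
  obtain ⟨D, N, heq⟩ := hsol.equation
  let Q : Holder k θ → Holder k θ := fun f ↦ f + (1 / 2 : ℝ) • Holder.mul h0 h1 f f
  let F : Holder k θ → Holder (k + 1) θ := fun f ↦ -Holder.smoothing h0 h1 (Q f)
  have hF : ContDiff ℝ ∞ F := by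
    refine ((Holder.smoothing h0 h1).contDiff.comp ?_).neg
    exact contDiff_id.add
      (((Holder.mul h0 h1).contDiff.clm_apply contDiff_id).const_smul (1 / 2 : ℝ))
  have hQ : ∀ f, (Q f).toFun = fun x ↦ f.toFun x + f.toFun x ^ 2 / 2 := fun f ↦ by
    ext x
    simp only [Q, map_add, map_smul, Holder.toFun_mul, Pi.add_apply, Pi.smul_apply, Pi.mul_apply,
      smul_eq_mul]
    ring
  have h0T : (0 : ℝ) ∈ Icc (-T) T := ⟨by linarith, hT.le⟩
  have hDU : ∀ t ∈ Icc (-T) T, ∀ ψ, D t ψ = Holder.eval k θ ψ (U t) := fun t ht ψ ↦ by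
    rw [((heq t ht).1 ψ).2, Holder.eval_apply, hU t ht]
  obtain ⟨V, hV, hVU⟩ := exists_contDiffOn_lift_of_weak_ode
    (Holder.inclusion h0 h1) hF hT hUc.continuousOn (Holder.eval k θ)
    (fun x hx ↦ Holder.eq_zero_of_eval_eq_zero hx)
    (fun t ht ψ ↦ by
      have hN : IsFunction (N t) (Q (U t)).toFun := by
        rw [hQ, hU t ht]
        exact (heq t ht).2.1
      have h := (heq t ht).2.2 ψ
      rw [((hN.smoothingFun (Q (U t)).memHolder.continuous (Q (U t)).abs_toFun_le) ψ).2] at h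
      have h2 : HasDerivWithinAt (fun τ ↦ Holder.eval k θ ψ (U τ)) _ (Icc (-T) T) t :=
        h.congr (fun τ hτ ↦ (hDU τ hτ ψ).symm) (hDU t ht ψ).symm
      convert! h2 using 1
      rw [map_neg, map_neg]
      rfl)
  refine ⟨V, hV, fun t ht ↦ ?_⟩
  have h2 : u 0 = u₀ := by
    refine (Continuous.ae_eq_iff_eq volume ?_ hu₀.continuous).1 hsol.initial
    rw [← hU 0 h0T]
    exact (U 0).memHolder.continuous
  rw [← Holder.toFun_inclusion h0 h1, hVU t ht, map_sub, hU t ht, hU 0 h0T, h2]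
  rfl

end BBM

end

theorem mainTheorem9 :
    (∀ (s T : ℝ) (u₀ : ℝ → ℝ) (u : ℝ → ℝ → ℝ), 0 ≤ s → 0 < T →
      BBM.MemSobolev s u₀ → BBM.ContDiffInSobolev 0 T s u → BBM.IsSolution T u₀ u →
        (s ≤ 1 / 2 → ∀ σ : ℝ, σ < 2 * s + 1 / 2 →
          BBM.ContDiffInSobolev ∞ T σ (fun t x ↦ u t x - u₀ x)) ∧
        (1 / 2 < s → BBM.ContDiffInSobolev ∞ T (s + 1) (fun t x ↦ u t x - u₀ x))) ∧
    (∀ (k : ℕ) (θ T : ℝ) (u₀ : ℝ → ℝ) (u : ℝ → ℝ → ℝ), 0 ≤ θ → θ ≤ 1 → 0 < T →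
      BBM.MemHolder k θ u₀ → BBM.ContDiffInHolder 0 T k θ u → BBM.IsSolution T u₀ u →
        BBM.ContDiffInHolder ∞ T (k + 1) θ (fun t x ↦ u t x - u₀ x)) := by
  refine ⟨fun s T u₀ u hs hT _ hu hsol ↦ ⟨fun hs' σ hσ ↦ ?_, fun hs' ↦ ?_⟩,
    fun k θ T u₀ u h0 h1 hT hu₀ hu hsol ↦ BBM.contDiffInHolder_succ h0 h1 hT hu₀ hu hsol⟩
  · have hr := le_max_left (σ - 1) (s - 1)
    have hr' := le_max_right (σ - 1) (s - 1)
    exact BBM.contDiffInSobolev_of_lt (r := max (σ - 1) (s - 1)) hs hT hu hsol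
      (max_le (by linarith) (by linarith)) (max_lt (by linarith) (by linarith)) (by linarith)
      (by linarith)
  · exact BBM.contDiffInSobolev_of_lt (r := s) hs hT hu hsol le_rfl (by linarith) (by linarith)
      le_rfl
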